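/- Let $p\in\mathbb N$, let $X=(X^1,\dots,X^p)$ be a random vector of $\mathbb R^p$ with law $\mathbb Q$ and independent components, let $f:\mathbb R^p\to\mathbb R$ be measurable, and set $Y=f(X)$. Let $\Upsilon$ be the set of all subsets of $\{1,\dots,p\}$. Assume $\mathbb E[Y^4]<\infty$ and $\mathrm{Var}(Y)>0$. The Sobol' indices of $Y$ are $\mathbf S^*=(S^*_u)_{u\in\Upsilon}$, $$S^*_u=\frac{1}{\mathrm{Var}(Y)}\sum_{v\subset u}(-1)^{|u|-|v|}\,\mathrm{Var}\big(\mathbb E[Y\mid X^i,\ i\in v]\big).$$ Let $\Delta=\{s\in\mathbb R^\Upsilon:\ s_u\ge 0\ \forall u,\ s_\emptyset=0,\ \sum_u s_u=1\}$, and let $\mathcal D_h(w,v)=h(w)-h(v)-\langle\nabla h(v),w-v\rangle$ be the Bregman divergence of the negative entropy $h(v)=\sum_u v_u\log v_u$, where $0\log 0=0$, for $w,v\in\Delta$ with $v_u>0$ for all $u\ne\emptyset$; the coordinate $\emptyset$, where $w_\emptyset=v_\emptyset=0$, does not contribute. Let $\mathbf M^{-1}$ be the matrix $\mathbf M^{-1}_{u,v}=\mathbf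 1_{v\subset u}$, the inverse of $\mathbf M_{u,v}=(-1)^{|u|-|v|}\mathbf 1_{v\subset u}$, $u,v\in\Upsilon$. Let $a=(a_u)_{u\in\Upsilon}$ be a probability distribution on $\Upsilon$ with $a_u>0$ for every $u\neq\emptyset$ (the value $a_\emptyset\ge0$ may be zero or positive). Let $(\eta_n)_{n\ge1}$ be positive step sizes with $\sum_n\eta_n=\infty$ and $\sum_n\eta_n^2<\infty$. Let $(X_n,X'_n,U_n)_{n\ge1}$ be i.i.d. with law $\mathbb Q\otimes\mathbb Q\otimes\sum_u a_u\delta_u$. Set $Y_n=f(X_n)$ and $Y^{(U)}_n=f(X_n^{U_n})$, where the $i$-th coordinate of $X_n^{U_n}$ is $X_n^i$ if $i\in U_n$ and $X_n'^i$ otherwise. Let $\widehat m_0=0$ and $\widehat m_n=\frac1n\sum_{k=1}^nY_k$ for $n\ge1$, and, for $s\in\mathbb R^\Upsilon$ and $n\ge 0$, $$\widehat{\nabla\phi}_{n+1}(s)=(Y_{n+1}-\widehat m_n)\,\Big[(Y_{n+1}-\widehat m_n)[\mathbf M^{-1}s]_{U_{n+1}}-(Y^{(U)}_{n+1}-\widehat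 m_n)\Big]\,\mathbf M^{-1}_{U_{n+1},:}\ .$$ Start from a deterministic $\hat{\mathbf S}_0\in\Delta$ with $(\hat{\mathbf S}_0)_u>0$ for all $u\neq\emptyset$ (for example the uniform distribution on the nonempty subsets) and define, for $n\ge0$, with products and exponentials taken coordinatewise, $$\hat{\mathbf S}_{n+1}=\frac{\hat{\mathbf S}_ne^{-\eta_{n+1}\widehat{\nabla\phi}_{n+1}(\hat{\mathbf S}_n)}}{\big\|\hat{\mathbf S}_ne^{-\eta_{n+1}\widehat{\nabla\phi}_{n+1}(\hat{\mathbf S}_n)}\big\|_1}.$$ Then, for every $n\ge 0$ and every realization, $\hat{\mathbf S}_{n+1}$ is the unique minimizer over $s\in\Delta$ of $$\big\langle\widehat{\nabla\phi}_{n+1}(\hat{\mathbf S}_n),s-\hat{\mathbf S}_n\big\rangle+\frac1{\eta_{n+1}}\mathcal D_h(s,\hat{\mathbf S}_n),$$ so that $(\hat{\mathbf S}_n)_{n\ge0}$ is the stochastic mirror descent, and $\hat{\mathbf S}_n\to\mathbf S^*$ almost surely as $n\to\infty$. -/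

import Mathlib

open MeasureTheory ProbabilityTheory Filter Topology

namespace PickFreeze

/-- Real vectors indexed by all subsets of the set of inputs `{1, …, p}` (modelled as `Fin p`). -/
abbrev SubsetVec (p : ℕ) : Type := Finset (Fin p) → ℝ

/-- `Var (E[Y | X^i, i ∈ v])` for `Y = f (X)` and `X` of law `Q`, computed on the canonical space
`(ℝ^p, Q)`: the conditioning σ-algebra is the one generated by the coordinates `x ↦ x i`, `i ∈ v`. -/
noncomputable def closedVariance {p : ℕ} (Q : Measure (Fin p → ℝ)) (f : (Fin p → ℝ) → ℝ)
    (v : Finset (Fin p)) : ℝ :=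
  Var[Q[f | cylinderEvents (X := fun _ : Fin p => ℝ) (v : Set (Fin p))]; Q]

/-- The part `V_u = ∑_{v ⊆ u} (-1)^{|u|-|v|} Var (E[Y | X^i, i ∈ v])` of the variance of `Y`. -/
noncomputable def partialVariance {p : ℕ} (Q : Measure (Fin p → ℝ)) (f : (Fin p → ℝ) → ℝ)
    (u : Finset (Fin p)) : ℝ :=
  ∑ v ∈ u.powerset, (-1 : ℝ) ^ (u.card - v.card) * closedVariance Q f v

/-- The vector of Sobol' indices, `S*_u = V_u / Var Y`. -/
noncomputable def sobolIndex {p : ℕ} (Q : Measure (Fin p → ℝ)) (f : (Fin p → ℝ) → ℝ) :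
    SubsetVec p :=
  fun u => partialVariance Q f u / Var[f; Q]

/-- The simplex of probability vectors over the subsets that give no mass to `∅`. -/
def simplex (p : ℕ) : Set (SubsetVec p) :=
  {s | (∀ u, 0 ≤ s u) ∧ s ∅ = 0 ∧ ∑ u, s u = 1}

/-- The law on subsets that gives mass `a u` to `{u}`. -/
noncomputable def subsetLaw {p : ℕ} (a : SubsetVec p) : Measure (Finset (Fin p)) :=
  ∑ u, ENNReal.ofReal (a u) • Measure.dirac u

/-- The matrix `M` with `M_{u,v} = (-1)^{|u|-|v|} 1_{v ⊆ u}`, which sends closed Sobol' indices to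
Sobol' indices. -/
def mobiusMatrix (p : ℕ) : Matrix (Finset (Fin p)) (Finset (Fin p)) ℝ :=
  Matrix.of fun u v => if v ⊆ u then (-1 : ℝ) ^ (u.card - v.card) else 0

/-- The inverse `M⁻¹` of `mobiusMatrix` (see `inv_mobiusMatrix`), `M⁻¹_{u,v} = 1_{v ⊆ u}`. -/
def zetaMatrix (p : ℕ) : Matrix (Finset (Fin p)) (Finset (Fin p)) ℝ :=
  Matrix.of fun u v => if v ⊆ u then 1 else 0

theorem zetaMatrix_mul_mobiusMatrix (p : ℕ) : zetaMatrix p * mobiusMatrix p = 1 := by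
  ext u w
  have h1 : (zetaMatrix p * mobiusMatrix p) u w =
      ∑ v ∈ Finset.Icc w u, (-1 : ℝ) ^ (v.card - w.card) := by
    rw [Matrix.mul_apply, ← Finset.sum_subset (Finset.subset_univ (Finset.Icc w u))]
    · refine Finset.sum_congr rfl fun v hv => ?_
      obtain ⟨hw, hu⟩ := Finset.mem_Icc.1 hv
      simp [zetaMatrix, mobiusMatrix, hw, hu]
    · intro v _ hv
      rw [Finset.mem_Icc] at hv
      simp only [zetaMatrix, mobiusMatrix, Matrix.of_apply]
      by_cases hu : v ⊆ u <;> by_cases hw : w ⊆ v <;> simp_all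
  rw [h1, Matrix.one_apply]
  by_cases hwu : w ⊆ u
  · rw [Finset.Icc_eq_image_powerset hwu, Finset.sum_image]
    · have h2 : ∀ t ∈ (u \ w).powerset, (-1 : ℝ) ^ ((w ∪ t).card - w.card) = (-1) ^ t.card := by
        intro t ht
        have hd : Disjoint w t :=
          (Finset.disjoint_sdiff.mono_right (Finset.mem_powerset.1 ht))
        rw [Finset.card_union_of_disjoint hd, Nat.add_sub_cancel_left]
      rw [Finset.sum_congr rfl h2]
      have h3 := congrArg (Int.cast : ℤ → ℝ) (Finset.sum_powerset_neg_one_pow_card (x := u \ w))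
      push_cast at h3
      rw [h3]
      have h4 : u \ w = ∅ ↔ u = w := by
        rw [Finset.sdiff_eq_empty_iff_subset]
        exact ⟨fun h => h.antisymm hwu, fun h => h.subset⟩
      simp [h4]
    · intro t ht t' ht' h
      have hd : ∀ r ∈ (u \ w).powerset, (w ∪ r) \ w = r := by
        intro r hr
        rw [Finset.union_sdiff_left]
        exact Finset.sdiff_eq_self_of_disjoint
          (Finset.disjoint_sdiff.mono_right (Finset.mem_powerset.1 hr)).symm
      rw [← hd t ht, ← hd t' ht']
      exact congrArg (· \ w) h
  · rw [Finset.Icc_eq_empty (by simpa using hwu), Finset.sum_empty, if_neg]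
    rintro rfl
    exact hwu subset_rfl

theorem inv_mobiusMatrix (p : ℕ) : (mobiusMatrix p)⁻¹ = zetaMatrix p :=
  Matrix.inv_eq_left_inv (zetaMatrix_mul_mobiusMatrix p)

/-- The pick-freeze input `x^{(u)}`: the coordinates in `u` are those of `x`, the others those of
`x'`. -/
def freeze {p : ℕ} (u : Finset (Fin p)) (x x' : Fin p → ℝ) : Fin p → ℝ :=
  fun i => if i ∈ u then x i else x' i

/-- The empirical mean of the first `n` outputs `f (x 0), …, f (x (n - 1))`; it is `0` for
`n = 0`. -/
noncomputable def empiricalMean {p : ℕ} (f : (Fin p → ℝ) → ℝ) (x : ℕ → Fin p → ℝ) (n : ℕ) : ℝ :=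
  (n : ℝ)⁻¹ * ∑ k ∈ Finset.range n, f (x k)

/-- The gradient estimate at `s` built from one sample `(x, x', u)`, with `m` in place of the unknown
mean: `(y - m) M⁻¹_{u,:} ((y - m) [M⁻¹ s]_u - (y^{(u)} - m))`, `y = f x`, `y^{(u)} = f x^{(u)}`. -/
noncomputable def gradEstimate {p : ℕ} (f : (Fin p → ℝ) → ℝ) (m : ℝ) (x x' : Fin p → ℝ)
    (u : Finset (Fin p)) (s : SubsetVec p) : SubsetVec p :=
  fun v => (f x - m) * zetaMatrix p u v *
    ((f x - m) * (zetaMatrix p).mulVec s u - (f (freeze u x x') - m))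

/-- The negative entropy `h (v) = ∑ v_u log v_u` (with `0 log 0 = 0`). -/
noncomputable def negEntropy {p : ℕ} (v : SubsetVec p) : ℝ :=
  ∑ u, v u * Real.log (v u)

/-- The Bregman divergence `D_h (w, v) = h (w) - h (v) - ⟨∇h (v), w - v⟩` of the negative entropy,
where `∇h (v)_u = log v_u + 1`. It is used for `w, v` in the simplex with `v u > 0` for `u ≠ ∅`; the
coordinate `∅` then does not contribute, since `w ∅ - v ∅ = 0`. -/
noncomputable def bregman {p : ℕ} (w v : SubsetVec p) : ℝ :=
  negEntropy w - negEntropy v - ∑ u, (Real.log (v u) + 1) * (w u - v u)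

/-- The function `s ↦ ⟨g, s - c⟩ + η⁻¹ D_h (s, c)` that a mirror descent step from `c`, with step
size `η` and gradient `g`, minimizes over the simplex. -/
noncomputable def mirrorObjective {p : ℕ} (η : ℝ) (g c s : SubsetVec p) : ℝ :=
  ∑ u, g u * (s u - c u) + 1 / η * bregman s c

/-- The explicit mirror descent step `c e^{-η g} / ‖c e^{-η g}‖₁` (coordinatewise product). -/
noncomputable def mirrorStep {p : ℕ} (η : ℝ) (g c : SubsetVec p) : SubsetVec p :=
  fun u => c u * Real.exp (-η * g u) / ∑ w, |c w * Real.exp (-η * g w)|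

/-- The gradient estimate used at step `n + 1` at the point `s`. The samples and step sizes are
numbered from `0`: `x n`, `x' n`, `u n`, `η n` are the `(n + 1)`-st ones, so this estimate uses the
sample `n + 1` and the empirical mean of the first `n` outputs only. -/
noncomputable def stepGradient {p : ℕ} (f : (Fin p → ℝ) → ℝ) (x x' : ℕ → Fin p → ℝ)
    (u : ℕ → Finset (Fin p)) (n : ℕ) (s : SubsetVec p) : SubsetVec p :=
  gradEstimate f (empiricalMean f x n) (x n) (x' n) (u n) s

/-- The iterates of the Pick-Freeze stochastic mirror descent started at `s₀`, driven by the samples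
`(x n, x' n, u n)` with step sizes `η n` (numbered from `0`). -/
noncomputable def iterates {p : ℕ} (f : (Fin p → ℝ) → ℝ) (η : ℕ → ℝ) (s₀ : SubsetVec p)
    (x x' : ℕ → Fin p → ℝ) (u : ℕ → Finset (Fin p)) : ℕ → SubsetVec p
  | 0 => s₀
  | n + 1 => mirrorStep (η n) (stepGradient f x x' u n (iterates f η s₀ x x' u n))
      (iterates f η s₀ x x' u n)

end PickFreeze

namespace PickFreeze

/-! The Lyapunov function is `relEntropy S* (S n)`. A mirror step from `c` multiplies the
coordinates by exponentials and renormalizes, so its effect on `relEntropy s` is an exact formula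
(`relEntropy_mirrorStep`). That formula turns the mirror objective into `relEntropy s (mirrorStep η
g c)` up to scaling and constants, which gives the unique minimizer. Hoeffding's lemma for the
normalizing constant gives the one-step inequality `relEntropy_mirrorStep_le`, with error `2 η² R²`.

The pick-freeze identity `E[Y Y^(u)] = E[E[Y | X^i, i ∈ u]²]` computes the mean of `⟨g, S* - s⟩` for
fixed `m` and `s` (`integral_sum_gradEstimate_mul`). It equals `-Var(Y)` times a weighted squared
distance `closedGap` between closed indices, plus a bias of size at most `(E Y - m)²`. All of this
takes place in the simplex, which contains `S*` because the partial variances are second moments of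
ANOVA components (`partialVariance_nonneg`).

Three errors remain along the trajectory: the noise, a martingale with summable second moments; the
bias, summable after weighting by `η` since `E(E Y - m_n)² = Var(Y)/n`; and the quadratic terms,
controlled by fourth moments and `∑ η² < ∞`. The Robbins-Siegmund argument
`exists_tendsto_and_frequently_lt` then makes the relative entropy converge and `closedGap` vanish
along a subsequence. There the iterates tend to `S*`, so the limit of the entropy is `0`, and the
Hellinger bound `sum_sq_sqrt_sub_sqrt_le_relEntropy` yields convergence of the whole sequence. -/

/-! ### Relative entropy on the simplex -/

/-- The Kullback-Leibler divergence of two vectors indexed by subsets. -/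
noncomputable def relEntropy {p : ℕ} (s t : SubsetVec p) : ℝ :=
  ∑ u, s u * (Real.log (s u) - Real.log (t u))

/-- The points of the simplex whose coordinates other than `∅` are positive. -/
def posSimplex (p : ℕ) : Set (SubsetVec p) :=
  {s | s ∈ simplex p ∧ ∀ u, u ≠ ∅ → 0 < s u}

/-- This is `log q ≤ q - 1` at `q = √y / √x`, multiplied by `2x`. The linear terms `-x + y` are kept
because they cancel when summed over two probability vectors. -/
theorem sq_sqrt_sub_sqrt_le {x y : ℝ} (hx : 0 ≤ x) (hy : 0 < y) :
    (√x - √y) ^ 2 ≤ x * (Real.log x - Real.log y) - x + y := by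
  rcases hx.eq_or_lt with rfl | hx
  · simp [Real.sq_sqrt hy.le]
  · obtain ⟨r, hr, rfl⟩ : ∃ r : ℝ, 0 < r ∧ x = r ^ 2 :=
      ⟨√x, Real.sqrt_pos.2 hx, (Real.sq_sqrt hx.le).symm⟩
    obtain ⟨t, ht, rfl⟩ : ∃ t : ℝ, 0 < t ∧ y = t ^ 2 :=
      ⟨√y, Real.sqrt_pos.2 hy, (Real.sq_sqrt hy.le).symm⟩
    rw [Real.sqrt_sq hr.le, Real.sqrt_sq ht.le, Real.log_pow, Real.log_pow]
    have h := Real.log_le_sub_one_of_pos (div_pos ht hr)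
    rw [Real.log_div ht.ne' hr.ne'] at h
    have h2 : r ^ 2 * (Real.log t - Real.log r) ≤ r ^ 2 * (t / r - 1) :=
      mul_le_mul_of_nonneg_left h (by positivity)
    have h3 : r ^ 2 * (t / r - 1) = r * t - r ^ 2 := by field_simp
    push_cast
    nlinarith

/-- Relative entropy dominates the squared Hellinger distance. Nonnegativity, strict positivity off
the diagonal, and convergence from vanishing entropy all follow from this. -/
theorem sum_sq_sqrt_sub_sqrt_le_relEntropy {p : ℕ} {s t : SubsetVec p} (hs : s ∈ simplex p)
    (ht : t ∈ posSimplex p) : ∑ u, (√(s u) - √(t u)) ^ 2 ≤ relEntropy s t := by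
  have h : ∀ u, (√(s u) - √(t u)) ^ 2 ≤ s u * (Real.log (s u) - Real.log (t u)) - s u + t u := by
    intro u
    by_cases hu : u = ∅
    · subst hu
      simp [hs.2.1, ht.1.2.1]
    · exact sq_sqrt_sub_sqrt_le (hs.1 u) (ht.2 u hu)
  refine (Finset.sum_le_sum fun u _ => h u).trans_eq ?_
  rw [Finset.sum_add_distrib, Finset.sum_sub_distrib, hs.2.2, ht.1.2.2, relEntropy]
  ring

theorem relEntropy_nonneg {p : ℕ} {s t : SubsetVec p} (hs : s ∈ simplex p)
    (ht : t ∈ posSimplex p) : 0 ≤ relEntropy s t :=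
  (Finset.sum_nonneg fun _ _ => sq_nonneg _).trans (sum_sq_sqrt_sub_sqrt_le_relEntropy hs ht)

theorem relEntropy_self {p : ℕ} (s : SubsetVec p) : relEntropy s s = 0 := by
  simp [relEntropy]

theorem relEntropy_pos {p : ℕ} {s t : SubsetVec p} (hs : s ∈ simplex p)
    (ht : t ∈ posSimplex p) (hst : s ≠ t) : 0 < relEntropy s t := by
  refine lt_of_lt_of_le ?_ (sum_sq_sqrt_sub_sqrt_le_relEntropy hs ht)
  obtain ⟨u, hu⟩ := Function.ne_iff.1 hst
  refine Finset.sum_pos' (fun _ _ => sq_nonneg _) ⟨u, Finset.mem_univ u, ?_⟩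
  have : √(s u) - √(t u) ≠ 0 := fun h =>
    hu ((Real.sqrt_inj (hs.1 u) (ht.1.1 u)).1 (sub_eq_zero.1 h))
  positivity

/-- Coordinates with `s u = 0` contribute nothing, and `log` is continuous at the others. Hence the
limit `s` may lie on the boundary, as the vector of Sobol' indices may. -/
theorem tendsto_relEntropy_self {p : ℕ} {ι : Type*} {l : Filter ι} {s : SubsetVec p}
    {t : ι → SubsetVec p} (h : Tendsto t l (𝓝 s)) :
    Tendsto (fun i => relEntropy s (t i)) l (𝓝 0) := by
  rw [← relEntropy_self s]
  refine tendsto_finsetSum _ fun u _ => ?_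
  by_cases hu : s u = 0
  · simp [hu, tendsto_const_nhds]
  · exact ((tendsto_const_nhds.sub ((tendsto_pi_nhds.1 h u).log hu))).const_mul _

theorem tendsto_of_relEntropy {p : ℕ} {ι : Type*} {l : Filter ι} {s : SubsetVec p}
    (hs : s ∈ simplex p) {t : ι → SubsetVec p} (ht : ∀ i, t i ∈ posSimplex p)
    (h : Tendsto (fun i => relEntropy s (t i)) l (𝓝 0)) : Tendsto t l (𝓝 s) := by
  refine tendsto_pi_nhds.2 fun u => ?_
  have h1 : Tendsto (fun i => (√(s u) - √(t i u)) ^ 2) l (𝓝 0) :=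
    squeeze_zero (fun _ => sq_nonneg _) (fun i => (Finset.single_le_sum
      (f := fun u => (√(s u) - √(t i u)) ^ 2) (fun _ _ => sq_nonneg _)
      (Finset.mem_univ u)).trans (sum_sq_sqrt_sub_sqrt_le_relEntropy hs (ht i))) h
  have h2 : Tendsto (fun i => |√(s u) - √(t i u)|) l (𝓝 0) := by
    simpa [Real.sqrt_sq_eq_abs] using h1.sqrt
  have h3 := (tendsto_const_nhds (x := √(s u))).sub ((tendsto_zero_iff_abs_tendsto_zero _).2 h2)
  have h4 := h3.pow 2
  simpa [Real.sq_sqrt (hs.1 u), fun i => Real.sq_sqrt ((ht i).1.1 u)] using h4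

/-! ### The mirror step: exact formula and one-step inequality -/

/-- The normalizing constant of a mirror descent step. -/
noncomputable def stepMass {p : ℕ} (η : ℝ) (g c : SubsetVec p) : ℝ :=
  ∑ w, c w * Real.exp (-η * g w)

theorem mirrorStep_apply {p : ℕ} {η : ℝ} {g c : SubsetVec p} (hc : c ∈ simplex p)
    (u : Finset (Fin p)) : mirrorStep η g c u = c u * Real.exp (-η * g u) / stepMass η g c := by
  have : ∀ w, |c w * Real.exp (-η * g w)| = c w * Real.exp (-η * g w) := fun w =>
    abs_of_nonneg (mul_nonneg (hc.1 w) (Real.exp_pos _).le)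
  simp only [mirrorStep, stepMass, this]

theorem stepMass_pos {p : ℕ} {η : ℝ} {g c : SubsetVec p} (hc : c ∈ simplex p) :
    0 < stepMass η g c := by
  refine Finset.sum_pos' (fun w _ => mul_nonneg (hc.1 w) (Real.exp_pos _).le) ?_
  by_contra! h
  have h0 : ∀ w, c w = 0 := fun w => by
    have := h w (Finset.mem_univ w)
    exact le_antisymm (nonpos_of_mul_nonpos_left this (Real.exp_pos _)) (hc.1 w)
  have := hc.2.2
  simp [h0] at this

theorem mirrorStep_mem {p : ℕ} {η : ℝ} {g c : SubsetVec p} (hc : c ∈ posSimplex p) :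
    mirrorStep η g c ∈ posSimplex p := by
  have hZ := stepMass_pos (η := η) (g := g) hc.1
  refine ⟨⟨fun u => ?_, ?_, ?_⟩, fun u hu => ?_⟩
  · rw [mirrorStep_apply hc.1]
    exact div_nonneg (mul_nonneg (hc.1.1 u) (Real.exp_pos _).le) hZ.le
  · rw [mirrorStep_apply hc.1, hc.1.2.1]
    simp
  · simp_rw [mirrorStep_apply hc.1]
    rw [← Finset.sum_div]
    exact div_self hZ.ne'
  · rw [mirrorStep_apply hc.1]
    exact div_pos (mul_pos (hc.2 u hu) (Real.exp_pos _)) hZ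

theorem log_mirrorStep {p : ℕ} {η : ℝ} {g c : SubsetVec p} (hc : c ∈ posSimplex p)
    {u : Finset (Fin p)} (hu : u ≠ ∅) :
    Real.log (mirrorStep η g c u) = Real.log (c u) - η * g u - Real.log (stepMass η g c) := by
  rw [mirrorStep_apply hc.1, Real.log_div (mul_pos (hc.2 u hu) (Real.exp_pos _)).ne'
    (stepMass_pos hc.1).ne', Real.log_mul (hc.2 u hu).ne' (Real.exp_pos _).ne', Real.log_exp]
  ring

/-- Off `∅` the logarithm of the step is `log c - η g` minus a constant; average this against `s`,
which has mass one. At `∅` the logarithm formula can fail because `log 0 = 0`, but there `s`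
vanishes. -/
theorem relEntropy_mirrorStep {p : ℕ} {η : ℝ} {g c s : SubsetVec p} (hs : s ∈ simplex p)
    (hc : c ∈ posSimplex p) :
    relEntropy s (mirrorStep η g c) =
      relEntropy s c + η * ∑ u, g u * s u + Real.log (stepMass η g c) := by
  have h : ∀ u, s u * (Real.log (s u) - Real.log (mirrorStep η g c u)) =
      s u * (Real.log (s u) - Real.log (c u)) + η * (g u * s u) +
        s u * Real.log (stepMass η g c) := by
    intro u
    by_cases hu : u = ∅
    · subst hu
      simp [hs.2.1]
    · rw [log_mirrorStep hc hu]
      ring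
  rw [relEntropy, Finset.sum_congr rfl fun u _ => h u, Finset.sum_add_distrib,
    Finset.sum_add_distrib, ← Finset.mul_sum, ← Finset.sum_mul, hs.2.2, one_mul, relEntropy]

/-- Between vectors of equal mass the Bregman divergence is the relative entropy, so the previous
identity completes the objective: only the divergence to the step point depends on `s`. -/
theorem mirrorObjective_eq {p : ℕ} {η : ℝ} (hη : 0 < η) {g c s : SubsetVec p} (hs : s ∈ simplex p)
    (hc : c ∈ posSimplex p) :
    mirrorObjective η g c s =
      1 / η * (relEntropy s (mirrorStep η g c) - Real.log (stepMass η g c)) - ∑ u, g u * c u := by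
  have h : bregman s c = relEntropy s c := by
    have : ∀ u, (Real.log (c u) + 1) * (s u - c u) =
        s u * Real.log (c u) - c u * Real.log (c u) + s u - c u := fun u => by ring
    simp only [bregman, negEntropy, relEntropy, this, Finset.sum_sub_distrib,
      Finset.sum_add_distrib, mul_sub, hs.2.2, hc.1.2.2]
    ring
  rw [relEntropy_mirrorStep hs hc, mirrorObjective, h]
  simp only [mul_sub, Finset.sum_sub_distrib]
  field_simp
  ring

theorem mirrorObjective_mirrorStep_lt {p : ℕ} {η : ℝ} (hη : 0 < η) {g c s : SubsetVec p}
    (hs : s ∈ simplex p) (hc : c ∈ posSimplex p) (hne : s ≠ mirrorStep η g c) :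
    mirrorObjective η g c (mirrorStep η g c) < mirrorObjective η g c s := by
  rw [mirrorObjective_eq hη hs hc, mirrorObjective_eq hη (mirrorStep_mem hc).1 hc,
    relEntropy_self]
  have := relEntropy_pos hs (mirrorStep_mem (η := η) (g := g) hc) hne
  gcongr

/-- The convexity step of Hoeffding's lemma: `exp` lies below its chord on `[-r, r]`, and the linear
part of the chord averages to zero. -/
theorem sum_mul_exp_le_cosh {ι : Type*} [Fintype ι] {c x : ι → ℝ} {r : ℝ} (hc : ∀ i, 0 ≤ c i)
    (hc1 : ∑ i, c i = 1) (hx : ∀ i, |x i| ≤ r) (hx0 : ∑ i, c i * x i = 0) :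
    ∑ i, c i * Real.exp (x i) ≤ Real.cosh r := by
  by_cases hr : r ≤ 0
  · have hx' : ∀ i, x i = 0 := fun i => abs_nonpos_iff.1 ((hx i).trans hr)
    simp [hx', hc1]
  push Not at hr
  have h : ∀ i, Real.exp (x i) ≤ Real.cosh r + x i * (Real.sinh r / r) := by
    intro i
    obtain ⟨h1, h2⟩ := abs_le.1 (hx i)
    have hcv := convexOn_exp.2
    have := hcv (Set.mem_univ (-r)) (Set.mem_univ r)
      (div_nonneg (by linarith) (by linarith) : 0 ≤ (r - x i) / (2 * r))
      (div_nonneg (by linarith) (by linarith) : 0 ≤ (r + x i) / (2 * r))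
      (by field_simp; ring)
    have e : ((r - x i) / (2 * r)) • (-r) + ((r + x i) / (2 * r)) • r = x i := by
      simp only [smul_eq_mul]
      field_simp
      ring
    rw [e] at this
    refine this.trans_eq ?_
    rw [Real.cosh_eq, Real.sinh_eq]
    simp only [smul_eq_mul]
    field_simp
    ring
  calc ∑ i, c i * Real.exp (x i)
      ≤ ∑ i, c i * (Real.cosh r + x i * (Real.sinh r / r)) :=
        Finset.sum_le_sum fun i _ => mul_le_mul_of_nonneg_left (h i) (hc i)
    _ = (∑ i, c i) * Real.cosh r + (∑ i, c i * x i) * (Real.sinh r / r) := by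
        rw [Finset.sum_mul, Finset.sum_mul, ← Finset.sum_add_distrib]
        exact Finset.sum_congr rfl fun i _ => by ring
    _ = Real.cosh r := by rw [hc1, hx0]; ring

theorem log_stepMass_le {p : ℕ} {η R : ℝ} (hη : 0 < η) {g c : SubsetVec p}
    (hc : c ∈ simplex p) (hg : ∀ u, |g u| ≤ R) :
    Real.log (stepMass η g c) ≤ -(η * ∑ u, g u * c u) + 2 * η ^ 2 * R ^ 2 := by
  set μ := ∑ u, g u * c u with hμ
  have hμR : |μ| ≤ R := by
    calc |μ| ≤ ∑ u, |g u * c u| := Finset.abs_sum_le_sum_abs _ _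
      _ ≤ ∑ u, R * c u := Finset.sum_le_sum fun u _ => by
          rw [abs_mul, abs_of_nonneg (hc.1 u)]
          exact mul_le_mul_of_nonneg_right (hg u) (hc.1 u)
      _ = R := by rw [← Finset.mul_sum, hc.2.2, mul_one]
  have h1 : stepMass η g c = Real.exp (-(η * μ)) * ∑ u, c u * Real.exp (-η * (g u - μ)) := by
    rw [stepMass, Finset.mul_sum]
    refine Finset.sum_congr rfl fun u _ => ?_
    rw [mul_left_comm, ← Real.exp_add]
    ring_nf
  -- The centred values satisfy `|g u - μ| ≤ 2R`; then `cosh (2ηR) ≤ exp ((2ηR)² / 2)` produces the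
  -- constant `2 η² R²`.
  have h2 : ∑ u, c u * Real.exp (-η * (g u - μ)) ≤ Real.cosh (2 * η * R) := by
    refine sum_mul_exp_le_cosh hc.1 hc.2.2 (fun u => ?_) ?_
    · rw [abs_mul, abs_neg, abs_of_pos hη]
      have : |g u - μ| ≤ R + R := (abs_sub _ _).trans (add_le_add (hg u) hμR)
      nlinarith
    · have : ∀ u, c u * (-η * (g u - μ)) = -η * (g u * c u) + η * μ * c u := fun u => by ring
      rw [Finset.sum_congr rfl fun u _ => this u, Finset.sum_add_distrib, ← Finset.mul_sum,
        ← Finset.mul_sum, hc.2.2]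
      ring
  rw [Real.log_le_iff_le_exp (stepMass_pos hc), h1, Real.exp_add]
  refine mul_le_mul_of_nonneg_left (h2.trans ((Real.cosh_le_exp_half_sq _).trans_eq ?_))
    (Real.exp_pos _).le
  ring_nf

theorem relEntropy_mirrorStep_le {p : ℕ} {η R : ℝ} (hη : 0 < η) {g c s : SubsetVec p}
    (hs : s ∈ simplex p) (hc : c ∈ posSimplex p) (hg : ∀ u, |g u| ≤ R) :
    relEntropy s (mirrorStep η g c) ≤
      relEntropy s c + η * ∑ u, g u * (s u - c u) + 2 * η ^ 2 * R ^ 2 := by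
  rw [relEntropy_mirrorStep hs hc]
  have := log_stepMass_le hη hc.1 hg
  simp only [mul_sub, Finset.sum_sub_distrib]
  linarith

/-! ### Convergence tools: Robbins-Siegmund, martingale series, past σ-algebras -/

/-- A deterministic Robbins-Siegmund lemma. -/
theorem exists_tendsto_and_frequently_lt {V Φ e η : ℕ → ℝ} (hV : ∀ n, 0 ≤ V n)
    (hΦ : ∀ n, 0 ≤ Φ n) (hη : ∀ n, 0 < η n)
    (hη_sum : Tendsto (fun N => ∑ n ∈ Finset.range N, η n) atTop atTop)
    (he : ∃ c, Tendsto (fun N => ∑ n ∈ Finset.range N, e n) atTop (𝓝 c))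
    (h : ∀ n, V (n + 1) ≤ V n - η n * Φ n + e n) :
    (∃ l, Tendsto V atTop (𝓝 l)) ∧ ∀ ε > 0, ∃ᶠ n in atTop, Φ n < ε := by
  obtain ⟨c, hc⟩ := he
  obtain ⟨B, hB⟩ := hc.bddAbove_range
  have hB' : ∀ N, ∑ n ∈ Finset.range N, e n ≤ B := fun N => hB ⟨N, rfl⟩
  -- Subtracting the partial sums of `e` leaves a nonincreasing sequence bounded below. Only
  -- convergence of these partial sums is needed, not absolute summability, so martingale noise is
  -- allowed in `e`.
  set A : ℕ → ℝ := fun N => V N - ∑ n ∈ Finset.range N, e n with hA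
  have hAB : ∀ N, -B ≤ A N := fun N => by
    have := hB' N
    have := hV N
    simp only [hA]
    linarith
  have hA1 : ∀ N, A (N + 1) ≤ A N - η N * Φ N := fun N => by
    have := h N
    simp only [hA, Finset.sum_range_succ]
    linarith
  constructor
  · have hanti : Antitone A := antitone_nat_of_succ_le fun N => by
      have := mul_nonneg (hη N).le (hΦ N)
      linarith [hA1 N]
    have hl := tendsto_atTop_ciInf hanti ⟨-B, by rintro _ ⟨N, rfl⟩; exact hAB N⟩
    refine ⟨_, (hl.add hc).congr fun N => ?_⟩
    simp [hA]
  · intro ε hε hf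
    obtain ⟨N, hN⟩ := eventually_atTop.1 hf
    -- If `Φ ≥ ε` from `N` on, then `A` falls by at least `ε ∑ η`, which diverges and contradicts
    -- the lower bound.
    have hdec : ∀ n ≥ N, A n + ε * ∑ k ∈ Finset.range n, η k ≤
        A N + ε * ∑ k ∈ Finset.range N, η k := by
      intro n hn
      induction n, hn using Nat.le_induction with
      | base => exact le_rfl
      | succ n hn ih =>
        have h1 := mul_le_mul_of_nonneg_left (not_lt.1 (hN n hn)) (hη n).le
        have h2 := hA1 n
        rw [Finset.sum_range_succ]
        linarith
    obtain ⟨n, hn, hn'⟩ := ((hη_sum.const_mul_atTop hε).eventually_gt_atTop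
      (A N + ε * ∑ k ∈ Finset.range N, η k + B)).and (eventually_ge_atTop N) |>.exists
    linarith [hdec n hn', hAB n]

theorem ae_summable_of_summable_integral {Ω : Type*} [MeasurableSpace Ω] {P : Measure Ω}
    {F : ℕ → Ω → ℝ} (h0 : ∀ n ω, 0 ≤ F n ω) (hF : ∀ n, Integrable (F n) P)
    (hsum : Summable fun n => ∫ ω, F n ω ∂P) : ∀ᵐ ω ∂P, Summable fun n => F n ω := by
  have h1 : ∀ n, eLpNorm (F n) 1 P = ENNReal.ofReal (∫ ω, F n ω ∂P) := fun n => by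
    rw [eLpNorm_one_eq_lintegral_enorm, ← ofReal_integral_norm_eq_lintegral_enorm (hF n)]
    simp only [Real.norm_of_nonneg (h0 n _)]
  have h2 : ∑' n, eLpNorm (F n) 1 P ≠ ⊤ := by
    simp_rw [h1]
    exact hsum.tsum_ofReal_ne_top
  filter_upwards [summable_norm_of_tsum_eLpNorm_ne_top le_rfl
    (fun n => (hF n).aestronglyMeasurable) h2] with ω hω
  simpa only [Real.norm_of_nonneg (h0 _ _)] using hω

/-- A series of martingale increments with summable second moments converges almost surely. -/
theorem ae_exists_tendsto_sum_of_orthogonal {Ω : Type*} {m0 : MeasurableSpace Ω} {P : Measure Ω}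
    [IsProbabilityMeasure P] (ℱ : Filtration ℕ m0) {ξ : ℕ → Ω → ℝ}
    (hmeas : ∀ n, StronglyMeasurable[ℱ (n + 1)] (ξ n)) (hL2 : ∀ n, MemLp (ξ n) 2 P)
    (horth : ∀ n (φ : Ω → ℝ), StronglyMeasurable[ℱ n] φ → MemLp φ 2 P →
      ∫ ω, φ ω * ξ n ω ∂P = 0)
    (hsum : Summable fun n => ∫ ω, ξ n ω ^ 2 ∂P) :
    ∀ᵐ ω ∂P, ∃ c, Tendsto (fun N => ∑ n ∈ Finset.range N, ξ n ω) atTop (𝓝 c) := by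
  set M : ℕ → Ω → ℝ := fun N ω => ∑ n ∈ Finset.range N, ξ n ω with hM
  have hMsucc : ∀ N ω, M (N + 1) ω = M N ω + ξ N ω := fun N ω => Finset.sum_range_succ _ _
  have hadp : StronglyAdapted ℱ M := fun N =>
    Finset.stronglyMeasurable_fun_sum _ fun n hn =>
      (hmeas n).mono (ℱ.mono (Finset.mem_range.1 hn))
  have hML2 : ∀ N, MemLp (M N) 2 P := fun N => memLp_finsetSum _ fun n _ => hL2 n
  have hint : ∀ N, Integrable (M N) P := fun N => (hML2 N).integrable one_le_two
  have hmart : Martingale M ℱ P := by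
    refine martingale_of_setIntegral_eq_succ hadp hint fun N s hs => ?_
    simp_rw [hMsucc]
    rw [integral_add (hint N).integrableOn ((hL2 N).integrable one_le_two).integrableOn]
    -- Testing `horth` on indicators of past events gives the martingale property; testing it on `M
    -- N` below removes the cross term in the second moment.
    have h := horth N (s.indicator fun _ => 1) (stronglyMeasurable_const.indicator hs)
      (memLp_indicator_const 2 (ℱ.le N s hs) 1 (Or.inr (measure_ne_top _ _)))
    rw [← integral_indicator (ℱ.le N s hs) (f := ξ N)]
    have e : ∀ ω, s.indicator (fun _ => (1 : ℝ)) ω * ξ N ω = s.indicator (ξ N) ω := fun ω => by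
      by_cases hω : ω ∈ s <;> simp [hω]
    simp_rw [e] at h
    rw [h, add_zero]
  have hsq : ∀ N, ∫ ω, M N ω ^ 2 ∂P = ∑ n ∈ Finset.range N, ∫ ω, ξ n ω ^ 2 ∂P := by
    intro N
    induction N with
    | zero => simp [hM]
    | succ N ih =>
      rw [Finset.sum_range_succ, ← ih]
      have e : ∀ ω, M (N + 1) ω ^ 2 = M N ω ^ 2 + 2 * (M N ω * ξ N ω) + ξ N ω ^ 2 := fun ω => by
        rw [hMsucc]
        ring
      have hi : Integrable (fun ω => M N ω * ξ N ω) P := (hML2 N).integrable_mul (hL2 N)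
      have hi2 : Integrable (fun ω => M N ω ^ 2 + 2 * (M N ω * ξ N ω)) P :=
        (hML2 N).integrable_sq.add (hi.const_mul 2)
      simp_rw [e]
      rw [integral_add hi2 (hL2 N).integrable_sq,
        integral_add (hML2 N).integrable_sq (hi.const_mul 2), integral_const_mul,
        horth N (M N) (hadp N) (hML2 N)]
      ring
  have hbdd : ∀ N, eLpNorm (M N) 1 P ≤ (1 + ∑' n, ∫ ω, ξ n ω ^ 2 ∂P).toNNReal := by
    intro N
    rw [eLpNorm_one_eq_lintegral_enorm, ← ofReal_integral_norm_eq_lintegral_enorm (hint N)]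
    refine ENNReal.ofReal_le_ofReal ?_
    calc ∫ ω, ‖M N ω‖ ∂P ≤ ∫ ω, (1 + M N ω ^ 2) ∂P := by
          refine integral_mono (hint N).norm ((integrable_const 1).add (hML2 N).integrable_sq)
            fun ω => ?_
          simp only [Real.norm_eq_abs]
          nlinarith [sq_nonneg (|M N ω| - 1), sq_abs (M N ω)]
      _ = 1 + ∑ n ∈ Finset.range N, ∫ ω, ξ n ω ^ 2 ∂P := by
          rw [integral_add (integrable_const 1) (hML2 N).integrable_sq, hsq]
          simp
      _ ≤ _ := by
          gcongr
          exact hsum.sum_le_tsum _ fun n _ => integral_nonneg fun _ => sq_nonneg _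
  filter_upwards [hmart.submartingale.ae_tendsto_limitProcess hbdd] with ω hω
  exact ⟨_, hω⟩

/-- Fubini under the product law of `(W, Z)`: the past `W` is frozen and only the fresh sample is
averaged. This replaces a computation of conditional expectations. -/
theorem integral_eq_zero_of_indepFun {Ω α β : Type*} [MeasurableSpace Ω] [MeasurableSpace α]
    [MeasurableSpace β] {P : Measure Ω} [IsProbabilityMeasure P] {W : Ω → α} {Z : Ω → β}
    (hind : IndepFun W Z P) (hW : Measurable W) (hZ : Measurable Z) {K : α → β → ℝ}
    (hK : Measurable (Function.uncurry K)) (hint : Integrable (fun ω => K (W ω) (Z ω)) P)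
    (h0 : ∀ w, ∫ z, K w z ∂(P.map Z) = 0) : ∫ ω, K (W ω) (Z ω) ∂P = 0 := by
  have hmap := (indepFun_iff_map_prod_eq_prod_map_map hW.aemeasurable hZ.aemeasurable).1 hind
  have := Measure.isProbabilityMeasure_map (μ := P) hW.aemeasurable
  have := Measure.isProbabilityMeasure_map (μ := P) hZ.aemeasurable
  have hi : Integrable (Function.uncurry K) ((P.map W).prod (P.map Z)) := by
    rw [← hmap, integrable_map_measure hK.aestronglyMeasurable (hW.prodMk hZ).aemeasurable]
    exact hint
  have e : ∫ ω, K (W ω) (Z ω) ∂P =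
      ∫ z, Function.uncurry K z ∂(P.map fun ω => (W ω, Z ω)) := by
    rw [integral_map (hW.prodMk hZ).aemeasurable hK.aestronglyMeasurable]
    rfl
  rw [e, hmap, integral_prod _ hi]
  simp [Function.uncurry, h0]

/-- The σ-algebras generated by the variables `Z k`, `k < n`. -/
def pastFiltration {Ω β : Type*} [m0 : MeasurableSpace Ω] [mβ : MeasurableSpace β] (Z : ℕ → Ω → β)
    (hZ : ∀ n, Measurable (Z n)) : Filtration ℕ m0 where
  seq n := ⨆ k ∈ Set.Iio n, mβ.comap (Z k)
  mono' _ _ h := biSup_mono fun _ hk => lt_of_lt_of_le hk h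
  le' _ := iSup₂_le fun k _ => (hZ k).comap_le

section pastFiltration

variable {Ω β : Type*} [MeasurableSpace Ω] [mβ : MeasurableSpace β] {Z : ℕ → Ω → β}
  (hZ : ∀ n, Measurable (Z n))

theorem measurable_pastFiltration {k n : ℕ} (h : k < n) :
    Measurable[pastFiltration Z hZ n] (Z k) :=
  measurable_iff_comap_le.2 (le_iSup₂_of_le k h le_rfl)

theorem indepFun_of_measurable_pastFiltration {α : Type*} [MeasurableSpace α] {P : Measure Ω}
    (hind : iIndepFun Z P) {n : ℕ} {W : Ω → α} (hW : Measurable[pastFiltration Z hZ n] W) :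
    IndepFun W (Z n) P := by
  have h := indep_iSup_of_disjoint (fun k => (hZ k).comap_le) hind.iIndep
    (S := Set.Iio n) (T := {n}) (by simp)
  rw [IndepFun_iff_Indep]
  exact indep_of_indep_of_le_left (indep_of_indep_of_le_right h
    (le_iSup₂_of_le n rfl le_rfl)) (measurable_iff_comap_le.1 hW)

end pastFiltration

/-! ### Pick-freeze inputs and conditional expectations -/

variable {p : ℕ}

theorem freeze_freeze (u : Finset (Fin p)) (x x' y : Fin p → ℝ) :
    freeze u (freeze u x x') y = freeze u x y := by
  ext i
  by_cases h : i ∈ u <;> simp [freeze, h]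

/-- The pointwise identity behind the fact that conditioning on `w` and then on `v` amounts to
conditioning on `v ∩ w`. -/
theorem freeze_freeze_inter (v w : Finset (Fin p)) (x y z : Fin p → ℝ) :
    freeze w (freeze v x y) z = freeze (v ∩ w) x (freeze w y z) := by
  ext i
  by_cases h : i ∈ w <;> by_cases h' : i ∈ v <;> simp [freeze, h, h']

theorem measurable_freeze_uncurry :
    Measurable fun z : (Fin p → ℝ) × (Fin p → ℝ) × Finset (Fin p) =>
      freeze z.2.2 z.1 z.2.1 := by
  refine measurable_pi_iff.2 fun i => ?_
  refine Measurable.ite ?_ (by fun_prop) (by fun_prop)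
  exact (measurableSet_mem_finset i).preimage (by fun_prop)

theorem measurable_freeze (u : Finset (Fin p)) :
    Measurable fun z : (Fin p → ℝ) × (Fin p → ℝ) => freeze u z.1 z.2 :=
  measurable_freeze_uncurry.comp (by fun_prop : Measurable fun z : (Fin p → ℝ) × (Fin p → ℝ) =>
    (z.1, z.2, u))

theorem measurable_cylinderEvents_freeze (u : Finset (Fin p)) (y : Fin p → ℝ) :
    Measurable[cylinderEvents (X := fun _ : Fin p => ℝ) (u : Set (Fin p))]
      fun x => freeze u x y := by
  refine @measurable_pi_lambda _ _ _ (_) _ _ fun i => ?_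
  by_cases hi : i ∈ u
  · simp only [freeze, hi, if_true]
    exact measurable_cylinderEvent_apply (by exact_mod_cast hi)
  · simp only [freeze, hi, if_false]
    exact @measurable_const _ _ _ (_) _

/-- Every such event is a preimage under `x ↦ freeze u x 0`, which forgets the coordinates outside
`u`. -/
theorem freeze_mem_iff_of_cylinderEvents {u : Finset (Fin p)} {A : Set (Fin p → ℝ)}
    (hA : MeasurableSet[cylinderEvents (X := fun _ : Fin p => ℝ) (u : Set (Fin p))] A)
    (x x' : Fin p → ℝ) : freeze u x x' ∈ A ↔ x ∈ A := by
  have hle : cylinderEvents (X := fun _ : Fin p => ℝ) (u : Set (Fin p)) ≤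
      MeasurableSpace.pi.comap fun x => freeze u x 0 := by
    refine iSup₂_le fun i hi => ?_
    have e : (fun x : Fin p → ℝ => x i) = (fun x => x i) ∘ fun x => freeze u x 0 := by
      ext x
      have hi' : i ∈ u := by exact_mod_cast hi
      simp [freeze, hi']
    rw [e, ← MeasurableSpace.comap_comp]
    exact MeasurableSpace.comap_mono (measurable_iff_comap_le.1 (measurable_pi_apply i))
  obtain ⟨B, -, rfl⟩ := hle A hA
  simp only [Set.mem_preimage, freeze_freeze]

section law

variable {Q : Measure (Fin p → ℝ)} [IsProbabilityMeasure Q]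

theorem eq_pi_of_iIndepFun (hQ : iIndepFun (fun (i : Fin p) (x : Fin p → ℝ) => x i) Q) :
    Q = Measure.pi fun i => Q.map fun x => x i := by
  rw [← (iIndepFun_iff_map_fun_eq_pi_map fun i => (measurable_pi_apply i).aemeasurable).1 hQ]
  exact Measure.map_id.symm

/-- Independence makes `Q` a product measure, so rectangles suffice. The preimage of a rectangle is
a product of two rectangles, one constraining the coordinates in `u`, the other those outside. -/
theorem measurePreserving_freeze (hQ : iIndepFun (fun (i : Fin p) (x : Fin p → ℝ) => x i) Q)
    (u : Finset (Fin p)) :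
    MeasurePreserving (fun z : (Fin p → ℝ) × (Fin p → ℝ) => freeze u z.1 z.2) (Q.prod Q) Q := by
  refine ⟨measurable_freeze u, ?_⟩
  have hprob : ∀ i, IsProbabilityMeasure (Q.map fun x => x i) := fun i =>
    Measure.isProbabilityMeasure_map (measurable_pi_apply i).aemeasurable
  have hpi := eq_pi_of_iIndepFun hQ
  have hrect : ∀ s : Fin p → Set ℝ, Q (Set.univ.pi s) = ∏ i, (Q.map fun x => x i) (s i) :=
    fun s => by
      conv_lhs => rw [hpi]
      rw [Measure.pi_pi]
  conv_rhs => rw [hpi]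
  refine (Measure.pi_eq fun s hs => ?_).symm
  rw [Measure.map_apply (measurable_freeze u) (MeasurableSet.univ_pi hs)]
  have e : (fun z : (Fin p → ℝ) × (Fin p → ℝ) => freeze u z.1 z.2) ⁻¹' Set.univ.pi s =
      (Set.univ.pi fun i => if i ∈ u then s i else Set.univ) ×ˢ
        (Set.univ.pi fun i => if i ∈ u then Set.univ else s i) := by
    ext z
    simp only [Set.mem_preimage, Set.mem_pi, Set.mem_univ, true_imp_iff, Set.mem_prod,
      ← forall_and]
    refine forall_congr' fun i => ?_
    by_cases hi : i ∈ u <;> simp [freeze, hi]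
  rw [e, Measure.prod_prod, hrect, hrect, ← Finset.prod_mul_distrib]
  refine Finset.prod_congr rfl fun i _ => ?_
  by_cases hi : i ∈ u <;> simp [hi]

/-- Disintegration over the finitely many values of the random subset; it reduces integrals of the
samples to weighted sums of integrals over `Q.prod Q`. -/
theorem prod_subsetLaw_eq (a : SubsetVec p) :
    Q.prod (Q.prod (subsetLaw a)) = ∑ u, ENNReal.ofReal (a u) •
      (Q.prod Q).map fun z : (Fin p → ℝ) × (Fin p → ℝ) => (z.1, z.2, u) := by
  have hfin : IsFiniteMeasure (subsetLaw a) := ⟨by simp [subsetLaw]⟩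
  refine Measure.ext_of_lintegral _ fun g hg => ?_
  rw [lintegral_prod _ hg.aemeasurable, lintegral_finsetSum_measure]
  have h1 : ∀ x, ∫⁻ y, g (x, y) ∂(Q.prod (subsetLaw a)) =
      ∑ u, ENNReal.ofReal (a u) * ∫⁻ x', g (x, x', u) ∂Q := by
    intro x
    rw [lintegral_prod _ (by fun_prop)]
    have : ∀ x', ∫⁻ u, g (x, x', u) ∂(subsetLaw a) =
        ∑ u, ENNReal.ofReal (a u) * g (x, x', u) := by
      intro x'
      rw [subsetLaw, lintegral_finsetSum_measure]
      simp [lintegral_smul_measure, lintegral_dirac]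
    simp_rw [this]
    rw [lintegral_finsetSum _ (fun u _ => by fun_prop)]
    exact Finset.sum_congr rfl fun u _ => lintegral_const_mul _ (by fun_prop)
  simp_rw [h1]
  have hm : ∀ u, Measurable fun z : (Fin p → ℝ) × (Fin p → ℝ) => g (z.1, z.2, u) := fun u => by
    fun_prop
  rw [lintegral_finsetSum _ fun u _ => ((hm u).lintegral_prod_right').const_mul _]
  refine Finset.sum_congr rfl fun u _ => ?_
  rw [lintegral_const_mul _ (hm u).lintegral_prod_right', lintegral_smul_measure,
    lintegral_map hg (by fun_prop), lintegral_prod _ (hm u).aemeasurable, smul_eq_mul]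

theorem integrable_prod_subsetLaw {a : SubsetVec p}
    {g : (Fin p → ℝ) × (Fin p → ℝ) × Finset (Fin p) → ℝ} (hg : Measurable g)
    (hi : ∀ u, Integrable (fun z : (Fin p → ℝ) × (Fin p → ℝ) => g (z.1, z.2, u)) (Q.prod Q)) :
    Integrable g (Q.prod (Q.prod (subsetLaw a))) := by
  rw [prod_subsetLaw_eq, integrable_finsetSum_measure]
  intro u _
  refine Integrable.smul_measure ?_ ENNReal.ofReal_ne_top
  rw [integrable_map_measure hg.aestronglyMeasurable (by fun_prop)]
  exact hi u

theorem integral_prod_subsetLaw {a : SubsetVec p} (ha : ∀ u, 0 ≤ a u)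
    {g : (Fin p → ℝ) × (Fin p → ℝ) × Finset (Fin p) → ℝ} (hg : Measurable g)
    (hi : ∀ u, Integrable (fun z : (Fin p → ℝ) × (Fin p → ℝ) => g (z.1, z.2, u)) (Q.prod Q)) :
    ∫ z, g z ∂(Q.prod (Q.prod (subsetLaw a))) =
      ∑ u, a u * ∫ z, g (z.1, z.2, u) ∂(Q.prod Q) := by
  rw [prod_subsetLaw_eq, integral_finsetSum_measure]
  · refine Finset.sum_congr rfl fun u _ => ?_
    rw [integral_smul_measure, integral_map (by fun_prop) hg.aestronglyMeasurable,
      ENNReal.toReal_ofReal (ha u), smul_eq_mul]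
  · intro u _
    refine Integrable.smul_measure ?_ ENNReal.ofReal_ne_top
    rw [integrable_map_measure hg.aestronglyMeasurable (by fun_prop)]
    exact hi u

end law

theorem integral_condExp_mul {Ω : Type*} {m m0 : MeasurableSpace Ω} {μ : Measure Ω}
    [IsProbabilityMeasure μ] (hm : m ≤ m0) {f g : Ω → ℝ} (hf : MemLp f 2 μ) (hg : MemLp g 2 μ)
    (hgm : StronglyMeasurable[m] g) : ∫ x, f x * g x ∂μ = ∫ x, (μ[f | m]) x * g x ∂μ := by
  rw [← integral_condExp hm]
  exact integral_congr_ae (condExp_mul_of_stronglyMeasurable_right hgm (hf.integrable_mul hg)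
    (hf.integrable one_le_two))

theorem freeze_empty (x x' : Fin p → ℝ) : freeze ∅ x x' = x' := by
  ext i
  simp [freeze]

theorem freeze_univ (x x' : Fin p → ℝ) : freeze Finset.univ x x' = x := by
  ext i
  simp [freeze]

/-- The function `x ↦ E[f (x^{(u)})]`, a version of the conditional expectation of `f` given the
coordinates in `u`. -/
noncomputable def freezeMean (Q : Measure (Fin p → ℝ)) (u : Finset (Fin p))
    (f : (Fin p → ℝ) → ℝ) (x : Fin p → ℝ) : ℝ :=
  ∫ x', f (freeze u x x') ∂Q

/-- The second moment of `freezeMean`. -/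
noncomputable def closedMoment (Q : Measure (Fin p → ℝ)) (f : (Fin p → ℝ) → ℝ)
    (u : Finset (Fin p)) : ℝ :=
  ∫ x, freezeMean Q u f x ^ 2 ∂Q

section law

variable {Q : Measure (Fin p → ℝ)} [IsProbabilityMeasure Q] {f : (Fin p → ℝ) → ℝ}

theorem measurable_freezeMean (hf : Measurable f) (u : Finset (Fin p)) :
    Measurable (freezeMean Q u f) :=
  ((hf.comp (measurable_freeze u)).stronglyMeasurable.integral_prod_right').measurable

theorem stronglyMeasurable_freezeMean (hf : Measurable f) (u : Finset (Fin p)) :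
    StronglyMeasurable[cylinderEvents (X := fun _ : Fin p => ℝ) (u : Set (Fin p))]
      (freezeMean Q u f) := by
  have e : freezeMean Q u f = freezeMean Q u f ∘ fun x => freeze u x 0 := by
    ext x
    simp only [freezeMean, Function.comp_apply, freeze_freeze]
  rw [e]
  exact ((measurable_freezeMean hf u).comp
    (measurable_cylinderEvents_freeze u 0)).stronglyMeasurable

/-- Freezing does not change membership in an event `s` of the conditioning σ-algebra, so the
integral over `s` becomes that of `s.indicator f` composed with `freeze`, and `freeze` preserves the
law. -/
theorem freezeMean_ae_eq_condExp
    (hQ : iIndepFun (fun (i : Fin p) (x : Fin p → ℝ) => x i) Q)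
    (hf : Measurable f) (hfi : Integrable f Q)
    (u : Finset (Fin p)) : freezeMean Q u f =ᵐ[Q]
      Q[f | cylinderEvents (X := fun _ : Fin p => ℝ) (u : Set (Fin p))] := by
  have hmp := measurePreserving_freeze hQ u
  have hi : Integrable (fun z : (Fin p → ℝ) × (Fin p → ℝ) => f (freeze u z.1 z.2)) (Q.prod Q) :=
    hmp.integrable_comp_of_integrable hfi
  refine ae_eq_condExp_of_forall_setIntegral_eq cylinderEvents_le_pi hfi
    (fun s _ _ => hi.integral_prod_left.integrableOn) (fun s hs _ => ?_)
    (stronglyMeasurable_freezeMean hf u).aestronglyMeasurable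
  have hs' := cylinderEvents_le_pi s hs
  rw [← integral_indicator hs', ← integral_indicator hs']
  have e1 : ∀ x, s.indicator (freezeMean Q u f) x =
      ∫ x', s.indicator f (freeze u x x') ∂Q := by
    intro x
    by_cases hx : x ∈ s
    · have : ∀ x', freeze u x x' ∈ s := fun x' => (freeze_mem_iff_of_cylinderEvents hs x x').2 hx
      simp [hx, this, freezeMean]
    · have : ∀ x', freeze u x x' ∉ s := fun x' =>
        mt (freeze_mem_iff_of_cylinderEvents hs x x').1 hx
      simp [hx, this]
  simp_rw [e1]
  have his : Integrable (s.indicator f) Q := hfi.indicator hs'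
  rw [← integral_prod (f := fun z : (Fin p → ℝ) × (Fin p → ℝ) => s.indicator f (freeze u z.1 z.2))
    (hmp.integrable_comp_of_integrable his)]
  conv_rhs => rw [← hmp.map_eq]
  rw [integral_map hmp.measurable.aemeasurable (hf.indicator hs').aestronglyMeasurable]

theorem memLp_freezeMean
    (hQ : iIndepFun (fun (i : Fin p) (x : Fin p → ℝ) => x i) Q)
    (hf : Measurable f) (hf2 : MemLp f 2 Q) (u : Finset (Fin p)) :
    MemLp (freezeMean Q u f) 2 Q :=
  (hf2.condExp one_le_two).ae_eq
    (freezeMean_ae_eq_condExp hQ hf (hf2.integrable one_le_two) u).symm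

theorem integral_freezeMean
    (hQ : iIndepFun (fun (i : Fin p) (x : Fin p → ℝ) => x i) Q)
    (hf : Measurable f) (hfi : Integrable f Q) (u : Finset (Fin p)) :
    ∫ x, freezeMean Q u f x ∂Q = ∫ x, f x ∂Q := by
  rw [integral_congr_ae (freezeMean_ae_eq_condExp hQ hf hfi u),
    integral_condExp cylinderEvents_le_pi]

theorem integral_mul_freezeMean
    (hQ : iIndepFun (fun (i : Fin p) (x : Fin p → ℝ) => x i) Q)
    {g : (Fin p → ℝ) → ℝ} (hf : Measurable f) (hf2 : MemLp f 2 Q)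
    (hg : MemLp g 2 Q) (u : Finset (Fin p))
    (hgm : StronglyMeasurable[cylinderEvents (X := fun _ : Fin p => ℝ) (u : Set (Fin p))] g) :
    ∫ x, f x * g x ∂Q = ∫ x, freezeMean Q u f x * g x ∂Q := by
  rw [integral_condExp_mul cylinderEvents_le_pi hf2 hg hgm]
  refine integral_congr_ae ?_
  filter_upwards [freezeMean_ae_eq_condExp hQ hf (hf2.integrable one_le_two) u] with x hx
  rw [hx]

/-- The pick-freeze identity. -/
theorem integral_mul_freeze
    (hQ : iIndepFun (fun (i : Fin p) (x : Fin p → ℝ) => x i) Q)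
    (hf : Measurable f) (hf2 : MemLp f 2 Q) (u : Finset (Fin p)) :
    ∫ z, f z.1 * f (freeze u z.1 z.2) ∂(Q.prod Q) = closedMoment Q f u := by
  have h1 : MemLp (fun z : (Fin p → ℝ) × (Fin p → ℝ) => f z.1) 2 (Q.prod Q) :=
    hf2.comp_measurePreserving measurePreserving_fst
  have h2 : MemLp (fun z : (Fin p → ℝ) × (Fin p → ℝ) => f (freeze u z.1 z.2)) 2 (Q.prod Q) :=
    hf2.comp_measurePreserving (measurePreserving_freeze hQ u)
  have hi : Integrable (fun z : (Fin p → ℝ) × (Fin p → ℝ) => f z.1 * f (freeze u z.1 z.2))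
    (Q.prod Q) := h1.integrable_mul h2
  rw [integral_prod _ hi]
  simp only [integral_const_mul]
  refine (integral_mul_freezeMean hQ hf hf2 (memLp_freezeMean hQ hf hf2 u) u
    (stronglyMeasurable_freezeMean hf u)).trans ?_
  simp only [closedMoment, sq]

theorem closedVariance_eq
    (hQ : iIndepFun (fun (i : Fin p) (x : Fin p → ℝ) => x i) Q)
    (hf : Measurable f) (hf2 : MemLp f 2 Q) (u : Finset (Fin p)) :
    closedVariance Q f u = closedMoment Q f u - (∫ x, f x ∂Q) ^ 2 := by
  have h := freezeMean_ae_eq_condExp hQ hf (hf2.integrable one_le_two) u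
  rw [closedVariance, ← variance_congr h, variance_eq_sub (memLp_freezeMean hQ hf hf2 u),
    integral_freezeMean hQ hf (hf2.integrable one_le_two)]
  rfl

/-- The two integrations merge by Fubini, and `freeze w` of the two independent copies again has law
`Q`. The identity is almost sure since Fubini needs the section of `f` at `x` to be integrable. -/
theorem freezeMean_freezeMean
    (hQ : iIndepFun (fun (i : Fin p) (x : Fin p → ℝ) => x i) Q)
    (hf : Measurable f) (hfi : Integrable f Q)
    (v w : Finset (Fin p)) :
    freezeMean Q v (freezeMean Q w f) =ᵐ[Q] freezeMean Q (v ∩ w) f := by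
  have hmp := measurePreserving_freeze hQ w
  have hi := ((measurePreserving_freeze hQ (v ∩ w)).integrable_comp_of_integrable
    hfi).prod_right_ae
  filter_upwards [hi] with x hx
  simp only [Function.comp_def] at hx
  simp only [freezeMean, freeze_freeze_inter]
  rw [← integral_prod (f := fun z : (Fin p → ℝ) × (Fin p → ℝ) =>
    f (freeze (v ∩ w) x (freeze w z.1 z.2))) (hmp.integrable_comp_of_integrable hx)]
  conv_rhs => rw [← hmp.map_eq]
  have hm : Measurable fun y : Fin p → ℝ => freeze (v ∩ w) x y :=
    (measurable_freeze (v ∩ w)).comp measurable_prodMk_left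
  exact (integral_map hmp.measurable.aemeasurable (hf.comp hm).aestronglyMeasurable).symm

theorem integral_freezeMean_mul_freezeMean
    (hQ : iIndepFun (fun (i : Fin p) (x : Fin p → ℝ) => x i) Q)
    (hf : Measurable f) (hf2 : MemLp f 2 Q)
    (v w : Finset (Fin p)) :
    ∫ x, freezeMean Q v f x * freezeMean Q w f x ∂Q = closedMoment Q f (v ∩ w) := by
  have hfi := hf2.integrable one_le_two
  have h2 := memLp_freezeMean hQ hf hf2
  have hm := measurable_freezeMean (Q := Q) hf
  have hsm := stronglyMeasurable_freezeMean (Q := Q) hf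
  -- Project the first factor onto the coordinates in `v`, to which the second is measurable. A
  -- second use, with `v ∩ w` and `v`, projects the remaining factor as well.
  have key : ∀ v w, ∫ x, freezeMean Q w f x * freezeMean Q v f x ∂Q =
      ∫ x, freezeMean Q (v ∩ w) f x * freezeMean Q v f x ∂Q := by
    intro v w
    rw [integral_mul_freezeMean hQ (hm w) (h2 w) (h2 v) v (hsm v)]
    refine integral_congr_ae ?_
    filter_upwards [freezeMean_freezeMean hQ hf hfi v w] with x hx
    rw [hx]
  simp_rw [fun x => mul_comm (freezeMean Q v f x)]
  rw [key]
  simp_rw [fun x => mul_comm (freezeMean Q (v ∩ w) f x)]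
  rw [key (v ∩ w) v]
  have : v ∩ w ∩ v = v ∩ w := Finset.inter_eq_left.2 Finset.inter_subset_left
  rw [this]
  simp only [closedMoment, sq]

end law

/-! ### The Sobol' indices form a point of the simplex -/

/-- Choose `i ∈ u \ v` and pair `w` with `insert i w`: the intersection with `v` is the same and the
signs are opposite. -/
theorem sum_powerset_sign_inter (q : Finset (Fin p) → ℝ) {u v : Finset (Fin p)} (hv : v ⊆ u)
    (hne : v ≠ u) : ∑ w ∈ u.powerset, (-1 : ℝ) ^ (u.card - w.card) * q (v ∩ w) = 0 := by
  obtain ⟨i, hiu, hiv⟩ := Finset.exists_of_ssubset (hv.ssubset_of_ne hne)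
  rw [← Finset.insert_erase hiu, Finset.sum_powerset_insert (Finset.notMem_erase i u),
    ← Finset.sum_add_distrib]
  refine Finset.sum_eq_zero fun w hw => ?_
  have hw' := Finset.mem_powerset.1 hw
  have hiw : i ∉ w := fun h => Finset.notMem_erase i u (hw' h)
  have hc := Finset.card_le_card hw'
  rw [Finset.inter_insert_of_notMem hiv, Finset.card_insert_of_notMem (Finset.notMem_erase i u),
    Finset.card_insert_of_notMem hiw, Nat.add_sub_add_right, Nat.succ_sub hc, pow_succ]
  ring

theorem sum_powerset_sign_eq_zero {u : Finset (Fin p)} (hu : u ≠ ∅) :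
    ∑ w ∈ u.powerset, (-1 : ℝ) ^ (u.card - w.card) = 0 := by
  simpa using sum_powerset_sign_inter (fun _ => 1) (Finset.empty_subset u) hu.symm

theorem zetaMatrix_mulVec_sobolIndex (Q : Measure (Fin p → ℝ)) (f : (Fin p → ℝ) → ℝ)
    (u : Finset (Fin p)) :
    (zetaMatrix p).mulVec (sobolIndex Q f) u = closedVariance Q f u / Var[f; Q] := by
  have e : sobolIndex Q f = (mobiusMatrix p).mulVec fun v => closedVariance Q f v / Var[f; Q] := by
    ext u
    rw [sobolIndex, partialVariance, Matrix.mulVec, dotProduct, Finset.sum_div]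
    rw [← Finset.sum_subset (Finset.subset_univ u.powerset)]
    · refine Finset.sum_congr rfl fun v hv => ?_
      simp only [mobiusMatrix, Matrix.of_apply, if_pos (Finset.mem_powerset.1 hv)]
      ring
    · intro v _ hv
      simp only [mobiusMatrix, Matrix.of_apply, if_neg (mt Finset.mem_powerset.2 hv), zero_mul]
  rw [e, Matrix.mulVec_mulVec, zetaMatrix_mul_mobiusMatrix, Matrix.one_mulVec]

section sobol

variable {Q : Measure (Fin p → ℝ)} [IsProbabilityMeasure Q] {f : (Fin p → ℝ) → ℝ}

theorem closedVariance_empty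
    (hQ : iIndepFun (fun (i : Fin p) (x : Fin p → ℝ) => x i) Q)
    (hf : Measurable f) (hf2 : MemLp f 2 Q) : closedVariance Q f ∅ = 0 := by
  have h : ∀ x, freezeMean Q ∅ f x = ∫ x, f x ∂Q := fun x => by
    simp [freezeMean, freeze_empty]
  rw [closedVariance_eq hQ hf hf2, closedMoment]
  simp [h]

theorem closedVariance_univ
    (hQ : iIndepFun (fun (i : Fin p) (x : Fin p → ℝ) => x i) Q)
    (hf : Measurable f) (hf2 : MemLp f 2 Q) : closedVariance Q f Finset.univ = Var[f; Q] := by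
  have h : freezeMean Q Finset.univ f = f := by
    ext x
    simp [freezeMean, freeze_univ]
  rw [closedVariance_eq hQ hf hf2, closedMoment, h, variance_eq_sub hf2]
  rfl

/-- For `u ≠ ∅` the partial variance is the second moment of the ANOVA component `∑ v ⊆ u,
(-1)^(|u|-|v|) E[Y | X^i, i ∈ v]`. In the expanded square the inner alternating sum vanishes unless
`v = u`. The case `u = ∅` is separate because there the alternating sum of the squared means does
not cancel. -/
theorem partialVariance_nonneg
    (hQ : iIndepFun (fun (i : Fin p) (x : Fin p → ℝ) => x i) Q)
    (hf : Measurable f) (hf2 : MemLp f 2 Q) (u : Finset (Fin p)) : 0 ≤ partialVariance Q f u := by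
  by_cases hu : u = ∅
  · subst hu
    simp [partialVariance, closedVariance_empty hQ hf hf2]
  have h1 : partialVariance Q f u =
      ∑ v ∈ u.powerset, (-1 : ℝ) ^ (u.card - v.card) * closedMoment Q f v := by
    simp_rw [partialVariance, closedVariance_eq hQ hf hf2, mul_sub, Finset.sum_sub_distrib,
      ← Finset.sum_mul]
    rw [sum_powerset_sign_eq_zero hu]
    ring
  set g : (Fin p → ℝ) → ℝ := fun x =>
    ∑ v ∈ u.powerset, (-1 : ℝ) ^ (u.card - v.card) * freezeMean Q v f x with hg
  have h2 : ∫ x, g x ^ 2 ∂Q = partialVariance Q f u := by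
    have e : ∀ x, g x ^ 2 = ∑ v ∈ u.powerset, ∑ w ∈ u.powerset,
        (-1 : ℝ) ^ (u.card - v.card) * ((-1 : ℝ) ^ (u.card - w.card) *
          (freezeMean Q v f x * freezeMean Q w f x)) := by
      intro x
      rw [hg, sq, Finset.sum_mul_sum]
      exact Finset.sum_congr rfl fun v _ => Finset.sum_congr rfl fun w _ => by ring
    have hi : ∀ v w, Integrable (fun x => freezeMean Q v f x * freezeMean Q w f x) Q :=
      fun v w => (memLp_freezeMean hQ hf hf2 v).integrable_mul (memLp_freezeMean hQ hf hf2 w)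
    simp_rw [e]
    rw [integral_finsetSum _ fun v _ => integrable_finsetSum _ fun w _ =>
      ((hi v w).const_mul _).const_mul _]
    have e2 : ∀ v, ∫ x, ∑ w ∈ u.powerset, (-1 : ℝ) ^ (u.card - v.card) *
        ((-1 : ℝ) ^ (u.card - w.card) * (freezeMean Q v f x * freezeMean Q w f x)) ∂Q =
        (-1 : ℝ) ^ (u.card - v.card) *
          ∑ w ∈ u.powerset, (-1 : ℝ) ^ (u.card - w.card) * closedMoment Q f (v ∩ w) := by
      intro v
      rw [integral_finsetSum _ fun w _ => ((hi v w).const_mul _).const_mul _, Finset.mul_sum]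
      refine Finset.sum_congr rfl fun w _ => ?_
      rw [integral_const_mul, integral_const_mul,
        integral_freezeMean_mul_freezeMean hQ hf hf2]
    simp_rw [e2]
    rw [Finset.sum_eq_single_of_mem u (Finset.mem_powerset_self u), h1, Nat.sub_self, pow_zero,
      one_mul]
    · refine Finset.sum_congr rfl fun w hw => ?_
      rw [Finset.inter_eq_right.2 (Finset.mem_powerset.1 hw)]
    · intro v hv hne
      rw [sum_powerset_sign_inter _ (Finset.mem_powerset.1 hv) hne, mul_zero]
  rw [← h2]
  exact integral_nonneg fun x => sq_nonneg _

theorem sobolIndex_mem_simplex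
    (hQ : iIndepFun (fun (i : Fin p) (x : Fin p → ℝ) => x i) Q)
    (hf : Measurable f) (hf2 : MemLp f 2 Q) (hvar : 0 < Var[f; Q]) : sobolIndex Q f ∈ simplex p := by
  refine ⟨fun u => div_nonneg (partialVariance_nonneg hQ hf hf2 u) hvar.le, ?_, ?_⟩
  · simp [sobolIndex, partialVariance, closedVariance_empty hQ hf hf2]
  -- The total mass is the closed index of the full set, where conditioning does nothing.
  · have h := zetaMatrix_mulVec_sobolIndex Q f Finset.univ
    rw [closedVariance_univ hQ hf hf2, div_self hvar.ne'] at h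
    rw [← h]
    simp [Matrix.mulVec, dotProduct, zetaMatrix]

end sobol

/-! ### Closed indices and the gradient estimate -/

theorem zetaMatrix_mulVec_mem_Icc {s : SubsetVec p} (hs : s ∈ simplex p) (u : Finset (Fin p)) :
    (zetaMatrix p).mulVec s u ∈ Set.Icc (0 : ℝ) 1 := by
  have h : ∀ v, 0 ≤ zetaMatrix p u v * s v ∧ zetaMatrix p u v * s v ≤ s v := fun v => by
    have := hs.1 v
    by_cases hv : v ⊆ u <;> simp [zetaMatrix, hv, this]
  change (∑ v, zetaMatrix p u v * s v) ∈ Set.Icc (0 : ℝ) 1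
  exact ⟨Finset.sum_nonneg fun v _ => (h v).1,
    (Finset.sum_le_sum fun v _ => (h v).2).trans_eq hs.2.2⟩

/-- The weighted squared distance between the closed Sobol' indices of two vectors. -/
def closedGap (a s t : SubsetVec p) : ℝ :=
  ∑ u, a u * ((zetaMatrix p).mulVec s u - (zetaMatrix p).mulVec t u) ^ 2

theorem closedGap_nonneg {a : SubsetVec p} (ha : ∀ u, 0 ≤ a u) (s t : SubsetVec p) :
    0 ≤ closedGap a s t :=
  Finset.sum_nonneg fun u _ => mul_nonneg (ha u) (sq_nonneg _)

/-- Positive weights control each closed index with `u ≠ ∅`; the one at `∅` is zero throughout the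
simplex. The continuous map `mobiusMatrix` then recovers the vectors. -/
theorem tendsto_of_closedGap {ι : Type*} {l : Filter ι} {a : SubsetVec p} (ha : ∀ u, 0 ≤ a u)
    (ha_pos : ∀ u, u ≠ ∅ → 0 < a u) {s : SubsetVec p} (hs : s ∈ simplex p) {t : ι → SubsetVec p}
    (ht : ∀ i, t i ∈ simplex p) (h : Tendsto (fun i => closedGap a s (t i)) l (𝓝 0)) :
    Tendsto t l (𝓝 s) := by
  have hz : Tendsto (fun i => (zetaMatrix p).mulVec (t i)) l (𝓝 ((zetaMatrix p).mulVec s)) := by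
    refine tendsto_pi_nhds.2 fun u => ?_
    by_cases hu : u = ∅
    · subst hu
      have h0 : ∀ r ∈ simplex p, (zetaMatrix p).mulVec r ∅ = 0 := fun r hr => by
        simp [Matrix.mulVec, dotProduct, zetaMatrix, Finset.subset_empty, hr.2.1]
      simp only [h0 _ (ht _), h0 _ hs]
      exact tendsto_const_nhds
    · set d : ι → ℝ := fun i => (zetaMatrix p).mulVec s u - (zetaMatrix p).mulVec (t i) u with hd
      have h1 : Tendsto (fun i => a u * d i ^ 2) l (𝓝 0) :=
        squeeze_zero (fun i => mul_nonneg (ha u) (sq_nonneg _)) (fun i => Finset.single_le_sum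
          (f := fun u => a u * ((zetaMatrix p).mulVec s u - (zetaMatrix p).mulVec (t i) u) ^ 2)
          (fun v _ => mul_nonneg (ha v) (sq_nonneg _)) (Finset.mem_univ u)) h
      have h2 : Tendsto (fun i => |d i|) l (𝓝 0) := by
        have := (h1.const_mul (a u)⁻¹).sqrt
        simpa [inv_mul_cancel_left₀ (ha_pos u hu).ne', Real.sqrt_sq_eq_abs] using this
      simpa [hd] using (tendsto_const_nhds (x := (zetaMatrix p).mulVec s u)).sub
        ((tendsto_zero_iff_abs_tendsto_zero _).2 h2)
  have hmz : ∀ r : SubsetVec p, (mobiusMatrix p).mulVec ((zetaMatrix p).mulVec r) = r := fun r => by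
    rw [Matrix.mulVec_mulVec, mul_eq_one_comm.1 (zetaMatrix_mul_mobiusMatrix p),
      Matrix.one_mulVec]
  have hc : Continuous fun r : SubsetVec p => (mobiusMatrix p).mulVec r :=
    continuous_const.matrix_mulVec continuous_id
  simpa only [Function.comp_def, hmz] using (hc.tendsto _).comp hz

theorem sum_gradEstimate_mul (f : (Fin p → ℝ) → ℝ) (m : ℝ) (x x' : Fin p → ℝ)
    (u : Finset (Fin p)) (s t : SubsetVec p) :
    ∑ v, gradEstimate f m x x' u s v * (t v - s v) =
      (f x - m) * ((f x - m) * (zetaMatrix p).mulVec s u - (f (freeze u x x') - m)) *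
        ((zetaMatrix p).mulVec t u - (zetaMatrix p).mulVec s u) := by
  have e : (zetaMatrix p).mulVec t u - (zetaMatrix p).mulVec s u =
      ∑ v, zetaMatrix p u v * (t v - s v) := by
    simp only [Matrix.mulVec, dotProduct, mul_sub, Finset.sum_sub_distrib]
  rw [e, Finset.mul_sum]
  refine Finset.sum_congr rfl fun v _ => ?_
  rw [gradEstimate]
  ring

/-- A bound for the coordinates of the gradient estimate on the simplex. -/
noncomputable def gradBound (f : (Fin p → ℝ) → ℝ) (m : ℝ) (x x' : Fin p → ℝ)
    (u : Finset (Fin p)) : ℝ :=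
  |f x - m| * (|f x - m| + |f (freeze u x x') - m|)

theorem abs_gradFactor_le {f : (Fin p → ℝ) → ℝ} {m : ℝ} {x x' : Fin p → ℝ}
    {u : Finset (Fin p)} {s : SubsetVec p} (hs : s ∈ simplex p) :
    |(f x - m) * ((f x - m) * (zetaMatrix p).mulVec s u - (f (freeze u x x') - m))| ≤
      gradBound f m x x' u := by
  obtain ⟨h0, h1⟩ := zetaMatrix_mulVec_mem_Icc hs u
  rw [gradBound, abs_mul]
  refine mul_le_mul_of_nonneg_left ((abs_sub _ _).trans ?_) (abs_nonneg _)
  rw [abs_mul, abs_of_nonneg h0]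
  gcongr
  exact mul_le_of_le_one_right (abs_nonneg _) h1

theorem abs_gradEstimate_le {f : (Fin p → ℝ) → ℝ} {m : ℝ} {x x' : Fin p → ℝ}
    {u : Finset (Fin p)} {s : SubsetVec p} (hs : s ∈ simplex p) (v : Finset (Fin p)) :
    |gradEstimate f m x x' u s v| ≤ gradBound f m x x' u := by
  refine le_trans ?_ (abs_gradFactor_le hs)
  rw [gradEstimate, mul_right_comm, abs_mul]
  refine mul_le_of_le_one_right (abs_nonneg _) ?_
  by_cases hv : v ⊆ u <;> simp [zetaMatrix, hv]

theorem abs_sum_gradEstimate_mul_le {f : (Fin p → ℝ) → ℝ} {m : ℝ} {x x' : Fin p → ℝ}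
    {u : Finset (Fin p)} {s t : SubsetVec p} (hs : s ∈ simplex p) (ht : t ∈ simplex p) :
    |∑ v, gradEstimate f m x x' u s v * (t v - s v)| ≤ gradBound f m x x' u := by
  obtain ⟨h0, h1⟩ := zetaMatrix_mulVec_mem_Icc hs u
  obtain ⟨h0', h1'⟩ := zetaMatrix_mulVec_mem_Icc ht u
  refine le_trans ?_ (abs_gradFactor_le hs)
  rw [sum_gradEstimate_mul, abs_mul]
  exact mul_le_of_le_one_right (abs_nonneg _) (abs_le.2 ⟨by linarith, by linarith⟩)

theorem sub_pow_four_le (x m : ℝ) : (x - m) ^ 4 ≤ 8 * (x ^ 4 + m ^ 4) := by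
  have h1 : (x - m) ^ 2 ≤ 2 * (x ^ 2 + m ^ 2) := by nlinarith [sq_nonneg (x + m)]
  have h2 : ((x - m) ^ 2) ^ 2 ≤ (2 * (x ^ 2 + m ^ 2)) ^ 2 := pow_le_pow_left₀ (sq_nonneg _) h1 2
  nlinarith [sq_nonneg (x ^ 2 - m ^ 2)]

theorem gradBound_sq_le (f : (Fin p → ℝ) → ℝ) (m : ℝ) (x x' : Fin p → ℝ)
    (u : Finset (Fin p)) : gradBound f m x x' u ^ 2 ≤
      24 * (f x ^ 4 + f (freeze u x x') ^ 4 + 2 * m ^ 4) := by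
  set y := f x with hy
  set z := f (freeze u x x') with hz
  have h1 := sub_pow_four_le y m
  have h2 := sub_pow_four_le z m
  have hA : |y - m| ^ 4 = (y - m) ^ 4 := by rw [show 4 = 2 * 2 from rfl, pow_mul, pow_mul, sq_abs]
  have hB : |z - m| ^ 4 = (z - m) ^ 4 := by rw [show 4 = 2 * 2 from rfl, pow_mul, pow_mul, sq_abs]
  set A := |y - m|
  set B := |z - m|
  -- The factor `3` here and the `8` from `sub_pow_four_le` multiply to the final `24`.
  have h3 : (A * (A + B)) ^ 2 ≤ 3 * (A ^ 4 + B ^ 4) := by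
    nlinarith [sq_nonneg (A ^ 2 - B ^ 2), mul_nonneg (sq_nonneg A) (sq_nonneg (A - B)),
      sq_nonneg (A ^ 2), sq_nonneg (B ^ 2)]
  have e : gradBound f m x x' u = A * (A + B) := rfl
  rw [e]
  linarith

theorem measurable_gradEstimate {f : (Fin p → ℝ) → ℝ} (hf : Measurable f) :
    Measurable fun q : (ℝ × SubsetVec p) × ((Fin p → ℝ) × (Fin p → ℝ) × Finset (Fin p)) =>
      gradEstimate f q.1.1 q.2.1 q.2.2.1 q.2.2.2 q.1.2 := by
  have hz : ∀ v, Measurable fun u : Finset (Fin p) => zetaMatrix p u v := fun v =>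
    measurable_of_countable _
  have hfr := hf.comp (measurable_freeze_uncurry (p := p))
  simp only [Function.comp_def] at hfr
  have hfr' : Measurable fun q : (ℝ × SubsetVec p) ×
      ((Fin p → ℝ) × (Fin p → ℝ) × Finset (Fin p)) => f (freeze q.2.2.2 q.2.1 q.2.2.1) :=
    hfr.comp measurable_snd
  refine measurable_pi_iff.2 fun v => ?_
  simp only [gradEstimate, Matrix.mulVec, dotProduct]
  exact Measurable.mul (by fun_prop) (Measurable.sub (by fun_prop) (hfr'.sub (by fun_prop)))

/-- The mean of the decrease `⟨gradEstimate, t - s⟩` when `t` is the vector of Sobol' indices. -/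
noncomputable def meanDrift (Q : Measure (Fin p → ℝ)) (f : (Fin p → ℝ) → ℝ) (a : SubsetVec p)
    (m : ℝ) (s : SubsetVec p) : ℝ :=
  ∑ u, a u * (((∫ x, f x ∂Q) - m) ^ 2 * ((zetaMatrix p).mulVec s u - 1) *
      ((zetaMatrix p).mulVec (sobolIndex Q f) u - (zetaMatrix p).mulVec s u)) -
    Var[f; Q] * closedGap a (sobolIndex Q f) s

theorem measurable_meanDrift (Q : Measure (Fin p → ℝ)) (f : (Fin p → ℝ) → ℝ) (a : SubsetVec p) :
    Measurable fun q : ℝ × SubsetVec p => meanDrift Q f a q.1 q.2 := by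
  simp only [meanDrift, closedGap, Matrix.mulVec, dotProduct]
  fun_prop

/-- Adding back the descent term leaves the bias caused by replacing the mean with `m`; its two
factors made of closed indices lie in `[-1, 1]`. -/
theorem abs_meanDrift_add_le {Q : Measure (Fin p → ℝ)} {f : (Fin p → ℝ) → ℝ} {a : SubsetVec p}
    (ha : ∀ u, 0 ≤ a u) (ha_sum : ∑ u, a u = 1) (hS : sobolIndex Q f ∈ simplex p) {m : ℝ}
    {s : SubsetVec p} (hs : s ∈ simplex p) :
    |meanDrift Q f a m s + Var[f; Q] * closedGap a (sobolIndex Q f) s| ≤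
      ((∫ x, f x ∂Q) - m) ^ 2 := by
  rw [meanDrift, sub_add_cancel]
  calc _ ≤ ∑ u, |a u * (((∫ x, f x ∂Q) - m) ^ 2 * ((zetaMatrix p).mulVec s u - 1) *
      ((zetaMatrix p).mulVec (sobolIndex Q f) u - (zetaMatrix p).mulVec s u))| :=
        Finset.abs_sum_le_sum_abs _ _
    _ ≤ ∑ u, a u * ((∫ x, f x ∂Q) - m) ^ 2 := by
        refine Finset.sum_le_sum fun u _ => ?_
        obtain ⟨h0, h1⟩ := zetaMatrix_mulVec_mem_Icc hs u
        obtain ⟨h0', h1'⟩ := zetaMatrix_mulVec_mem_Icc hS u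
        rw [abs_mul, abs_of_nonneg (ha u), abs_mul, abs_mul, abs_of_nonneg (sq_nonneg _)]
        refine mul_le_mul_of_nonneg_left ?_ (ha u)
        rw [mul_assoc]
        refine mul_le_of_le_one_right (sq_nonneg _) (mul_le_one₀ ?_ (abs_nonneg _) ?_)
        · exact abs_le.2 ⟨by linarith, by linarith⟩
        · exact abs_le.2 ⟨by linarith, by linarith⟩
    _ = _ := by rw [← Finset.sum_mul, ha_sum, one_mul]

theorem closedGap_le_one {a : SubsetVec p} (ha : ∀ u, 0 ≤ a u) (ha_sum : ∑ u, a u = 1)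
    {s t : SubsetVec p} (hs : s ∈ simplex p) (ht : t ∈ simplex p) : closedGap a s t ≤ 1 := by
  rw [← ha_sum]
  refine Finset.sum_le_sum fun u _ => mul_le_of_le_one_right (ha u) ?_
  obtain ⟨h0, h1⟩ := zetaMatrix_mulVec_mem_Icc hs u
  obtain ⟨h0', h1'⟩ := zetaMatrix_mulVec_mem_Icc ht u
  rw [sq_le_one_iff_abs_le_one]
  exact abs_le.2 ⟨by linarith, by linarith⟩

theorem meanDrift_sq_le {Q : Measure (Fin p → ℝ)} {f : (Fin p → ℝ) → ℝ} {a : SubsetVec p}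
    (ha : ∀ u, 0 ≤ a u) (ha_sum : ∑ u, a u = 1) (hS : sobolIndex Q f ∈ simplex p) {m : ℝ}
    {s : SubsetVec p} (hs : s ∈ simplex p) :
    meanDrift Q f a m s ^ 2 ≤ 2 * Var[f; Q] ^ 2 + 16 * ((∫ x, f x ∂Q) ^ 4 + m ^ 4) := by
  have h1 := abs_le.1 (abs_meanDrift_add_le ha ha_sum hS (m := m) hs)
  have h2 := sub_pow_four_le (∫ x, f x ∂Q) m
  have h3 := closedGap_le_one ha ha_sum hS hs
  have h4 := closedGap_nonneg ha (sobolIndex Q f) s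
  have hv := variance_nonneg f Q
  have h5 := mul_le_of_le_one_right hv h3
  have h6 := mul_nonneg hv h4
  set D := ((∫ x, f x ∂Q) - m) ^ 2 with hD
  have hD0 : 0 ≤ D := sq_nonneg _
  have e : ((∫ x, f x ∂Q) - m) ^ 4 = D ^ 2 := by rw [hD, ← pow_mul]
  rw [e] at h2
  have h7 : meanDrift Q f a m s ^ 2 ≤ (Var[f; Q] + D) ^ 2 := by
    rw [sq_le_sq, abs_of_nonneg (add_nonneg hv hD0)]
    exact abs_le.2 ⟨by linarith, by linarith⟩
  nlinarith [sq_nonneg (Var[f; Q] - D)]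

/-- With `c`, `c'` the closed indices of `s` and `S*` at `u`, pick-freeze gives `E[(Y-m)²] c -
E[(Y-m)(Y^(u)-m)] = Var(Y) (c - c') + (μ-m)² (c - 1)`. Multiplication by `c' - c` and averaging over
`u` give the drift. -/
theorem integral_sum_gradEstimate_mul {Q : Measure (Fin p → ℝ)} [IsProbabilityMeasure Q]
    (hQ : iIndepFun (fun (i : Fin p) (x : Fin p → ℝ) => x i) Q) {f : (Fin p → ℝ) → ℝ}
    (hf : Measurable f) (hf2 : MemLp f 2 Q) (hvar : 0 < Var[f; Q]) {a : SubsetVec p}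
    (ha : ∀ u, 0 ≤ a u) (m : ℝ) (s : SubsetVec p) :
    Integrable (fun z : (Fin p → ℝ) × (Fin p → ℝ) × Finset (Fin p) =>
        ∑ v, gradEstimate f m z.1 z.2.1 z.2.2 s v * (sobolIndex Q f v - s v))
        (Q.prod (Q.prod (subsetLaw a))) ∧
      ∫ z, ∑ v, gradEstimate f m z.1 z.2.1 z.2.2 s v * (sobolIndex Q f v - s v)
        ∂(Q.prod (Q.prod (subsetLaw a))) = meanDrift Q f a m s := by
  set μ := ∫ x, f x ∂Q with hμ
  have hfi := hf2.integrable one_le_two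
  have hgm : Measurable fun z : (Fin p → ℝ) × (Fin p → ℝ) × Finset (Fin p) =>
      ∑ v, gradEstimate f m z.1 z.2.1 z.2.2 s v * (sobolIndex Q f v - s v) := by
    have hg := (measurable_gradEstimate hf).comp (measurable_prodMk_left (x := (m, s)))
    exact Finset.measurable_sum _ fun v _ => ((measurable_pi_apply v).comp hg).mul_const _
  have key : ∀ u, Integrable (fun z : (Fin p → ℝ) × (Fin p → ℝ) =>
        ∑ v, gradEstimate f m z.1 z.2 u s v * (sobolIndex Q f v - s v)) (Q.prod Q) ∧
      ∫ z : (Fin p → ℝ) × (Fin p → ℝ),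
        ∑ v, gradEstimate f m z.1 z.2 u s v * (sobolIndex Q f v - s v) ∂(Q.prod Q) =
      (μ - m) ^ 2 * ((zetaMatrix p).mulVec s u - 1) *
        ((zetaMatrix p).mulVec (sobolIndex Q f) u - (zetaMatrix p).mulVec s u) -
      Var[f; Q] *
        ((zetaMatrix p).mulVec (sobolIndex Q f) u - (zetaMatrix p).mulVec s u) ^ 2 := by
    intro u
    have hfr := measurePreserving_freeze hQ u
    have hfst : MeasurePreserving Prod.fst (Q.prod Q) Q := measurePreserving_fst
    have m1 : MemLp (fun z : (Fin p → ℝ) × (Fin p → ℝ) => f z.1) 2 (Q.prod Q) :=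
      hf2.comp_measurePreserving hfst
    have m2 : MemLp (fun z : (Fin p → ℝ) × (Fin p → ℝ) => f (freeze u z.1 z.2)) 2 (Q.prod Q) :=
      hf2.comp_measurePreserving hfr
    have i1 := m1.integrable one_le_two
    have i2 := m2.integrable one_le_two
    have i11 := m1.integrable_sq
    have i12 : Integrable (fun z : (Fin p → ℝ) × (Fin p → ℝ) =>
      f z.1 * f (freeze u z.1 z.2)) (Q.prod Q) := m1.integrable_mul m2
    have e1 : ∫ z : (Fin p → ℝ) × (Fin p → ℝ), f z.1 ∂(Q.prod Q) = μ := by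
      rw [hμ, ← hfst.map_eq, integral_map hfst.measurable.aemeasurable
        hf.aestronglyMeasurable, hfst.map_eq]
    have e2 : ∫ z : (Fin p → ℝ) × (Fin p → ℝ), f (freeze u z.1 z.2) ∂(Q.prod Q) = μ := by
      rw [hμ]
      conv_rhs => rw [← hfr.map_eq]
      rw [integral_map hfr.measurable.aemeasurable hf.aestronglyMeasurable]
    have e11 : ∫ z : (Fin p → ℝ) × (Fin p → ℝ), f z.1 ^ 2 ∂(Q.prod Q) = Var[f; Q] + μ ^ 2 := by
      have := integral_map hfst.measurable.aemeasurable (hf.pow_const 2).aestronglyMeasurable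
        (μ := Q.prod Q)
      rw [hfst.map_eq] at this
      rw [← this, variance_eq_sub hf2, ← hμ, sub_add_cancel]
      rfl
    have e12 : ∫ z : (Fin p → ℝ) × (Fin p → ℝ), f z.1 * f (freeze u z.1 z.2) ∂(Q.prod Q) =
        Var[f; Q] * (zetaMatrix p).mulVec (sobolIndex Q f) u + μ ^ 2 := by
      rw [integral_mul_freeze hQ hf hf2, zetaMatrix_mulVec_sobolIndex,
        mul_div_cancel₀ _ hvar.ne', closedVariance_eq hQ hf hf2, sub_add_cancel]
    set c := (zetaMatrix p).mulVec s u
    set c' := (zetaMatrix p).mulVec (sobolIndex Q f) u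
    have e : ∀ z : (Fin p → ℝ) × (Fin p → ℝ),
        ∑ v, gradEstimate f m z.1 z.2 u s v * (sobolIndex Q f v - s v) =
        (c' - c) * c * f z.1 ^ 2 - (c' - c) * (f z.1 * f (freeze u z.1 z.2)) +
          (c' - c) * (m - 2 * m * c) * f z.1 + (c' - c) * m * f (freeze u z.1 z.2) +
          (c' - c) * (c * m ^ 2 - m ^ 2) := fun z => by
      rw [sum_gradEstimate_mul]
      ring
    have j1 : Integrable (fun z : (Fin p → ℝ) × (Fin p → ℝ) => (c' - c) * c * f z.1 ^ 2 -
        (c' - c) * (f z.1 * f (freeze u z.1 z.2))) (Q.prod Q) :=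
      (i11.const_mul _).sub (i12.const_mul _)
    have j2 := j1.add (i1.const_mul ((c' - c) * (m - 2 * m * c)))
    have j3 := j2.add (i2.const_mul ((c' - c) * m))
    simp only [Pi.add_def] at j2 j3
    simp_rw [e]
    refine ⟨j3.add (integrable_const _), ?_⟩
    rw [integral_add j3 (integrable_const _), integral_add j2 (i2.const_mul _),
      integral_add j1 (i1.const_mul _), integral_sub (i11.const_mul _) (i12.const_mul _),
      integral_const_mul, integral_const_mul, integral_const_mul, integral_const_mul,
      integral_const, e1, e2, e11, e12]
    simp only [probReal_univ, one_smul]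
    ring
  refine ⟨integrable_prod_subsetLaw hgm fun u => (key u).1, ?_⟩
  rw [integral_prod_subsetLaw ha hgm fun u => (key u).1, meanDrift, closedGap, Finset.mul_sum,
    ← Finset.sum_sub_distrib]
  refine Finset.sum_congr rfl fun u _ => ?_
  rw [(key u).2]
  ring

theorem isProbabilityMeasure_subsetLaw {a : SubsetVec p} (ha : ∀ u, 0 ≤ a u)
    (ha_sum : ∑ u, a u = 1) : IsProbabilityMeasure (subsetLaw a) :=
  ⟨by simp [subsetLaw, ← ENNReal.ofReal_sum_of_nonneg fun u _ => ha u, ha_sum]⟩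

theorem measurePreserving_freeze_subsetLaw {Q : Measure (Fin p → ℝ)} [IsProbabilityMeasure Q]
    (hQ : iIndepFun (fun (i : Fin p) (x : Fin p → ℝ) => x i) Q) {a : SubsetVec p}
    (ha : ∀ u, 0 ≤ a u) (ha_sum : ∑ u, a u = 1) :
    MeasurePreserving (fun z : (Fin p → ℝ) × (Fin p → ℝ) × Finset (Fin p) =>
      freeze z.2.2 z.1 z.2.1) (Q.prod (Q.prod (subsetLaw a))) Q := by
  refine ⟨measurable_freeze_uncurry, ?_⟩
  ext A hA
  have hm := measurable_freeze_uncurry (p := p) hA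
  rw [Measure.map_apply measurable_freeze_uncurry hA, prod_subsetLaw_eq, Measure.finsetSum_apply]
  have h : ∀ u, (ENNReal.ofReal (a u) • (Q.prod Q).map
      fun z : (Fin p → ℝ) × (Fin p → ℝ) => (z.1, z.2, u))
        ((fun z : (Fin p → ℝ) × (Fin p → ℝ) × Finset (Fin p) => freeze z.2.2 z.1 z.2.1) ⁻¹' A) =
      ENNReal.ofReal (a u) * Q A := fun u => by
    rw [Measure.smul_apply, Measure.map_apply (by fun_prop) hm, smul_eq_mul]
    conv_rhs => rw [← (measurePreserving_freeze hQ u).map_eq,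
      Measure.map_apply (measurable_freeze u) hA]
    rfl
  simp_rw [h]
  rw [← Finset.sum_mul, ← ENNReal.ofReal_sum_of_nonneg fun u _ => ha u, ha_sum]
  simp

/-! ### Moments of the empirical mean and measurability of the iterates -/

theorem integral_comp_measurePreserving {α β : Type*} [MeasurableSpace α] [MeasurableSpace β]
    {μ : Measure α} {ν : Measure β} {φ : α → β} (h : MeasurePreserving φ μ ν) {g : β → ℝ}
    (hg : Measurable g) : ∫ x, g (φ x) ∂μ = ∫ y, g y ∂ν := by
  rw [← h.map_eq, integral_map h.measurable.aemeasurable hg.aestronglyMeasurable]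

theorem empiricalMean_pow_four_le (f : (Fin p → ℝ) → ℝ) (x : ℕ → Fin p → ℝ) (n : ℕ) :
    empiricalMean f x n ^ 4 ≤ (n : ℝ)⁻¹ * ∑ k ∈ Finset.range n, f (x k) ^ 4 := by
  rcases Nat.eq_zero_or_pos n with rfl | hn
  · simp [empiricalMean]
  · have hn' : (n : ℝ) ≠ 0 := by positivity
    have := Real.pow_arith_mean_le_arith_mean_pow_of_even (Finset.range n) (fun _ => (n : ℝ)⁻¹)
      (fun k => f (x k)) (fun _ _ => by positivity) (by simp [hn']) (show Even 4 by decide)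
    rwa [← Finset.mul_sum, ← Finset.mul_sum] at this

theorem measurable_mirrorStep (η : ℝ) :
    Measurable fun q : SubsetVec p × SubsetVec p => mirrorStep η q.1 q.2 := by
  refine measurable_pi_iff.2 fun u => ?_
  simp only [mirrorStep]
  fun_prop

theorem iterates_mem_posSimplex (f : (Fin p → ℝ) → ℝ) (η : ℕ → ℝ) {s₀ : SubsetVec p}
    (hs₀ : s₀ ∈ posSimplex p) (x x' : ℕ → Fin p → ℝ) (u : ℕ → Finset (Fin p)) (n : ℕ) :
    iterates f η s₀ x x' u n ∈ posSimplex p := by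
  induction n with
  | zero => exact hs₀
  | succ n ih => exact mirrorStep_mem ih

section process

variable {Ω : Type*} [MeasurableSpace Ω] {X X' : ℕ → Ω → Fin p → ℝ} {U : ℕ → Ω → Finset (Fin p)}
  (hZ : ∀ n, Measurable fun ω => (X n ω, X' n ω, U n ω))

theorem measurable_empiricalMean {f : (Fin p → ℝ) → ℝ} (hf : Measurable f) (n : ℕ) :
    Measurable[pastFiltration (fun n ω => (X n ω, X' n ω, U n ω)) hZ n]
      fun ω => empiricalMean f (fun k => X k ω) n := by
  refine Measurable.const_mul (Finset.measurable_sum _ fun k hk => ?_) _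
  exact (hf.comp measurable_fst).comp (measurable_pastFiltration hZ (Finset.mem_range.1 hk))

/-- Samples are numbered from `0`, so iterate `n` uses samples `0, …, n - 1` only and sample `n` is
fresh. -/
theorem measurable_iterates {f : (Fin p → ℝ) → ℝ} (hf : Measurable f) (η : ℕ → ℝ)
    (s₀ : SubsetVec p) (n : ℕ) :
    Measurable[pastFiltration (fun n ω => (X n ω, X' n ω, U n ω)) hZ n]
      fun ω => iterates f η s₀ (fun k => X k ω) (fun k => X' k ω) (fun k => U k ω) n := by
  induction n with
  | zero => exact measurable_const
  | succ n ih =>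
    have hle := (pastFiltration (fun n ω => (X n ω, X' n ω, U n ω)) hZ).mono n.le_succ
    have h1 := (measurable_empiricalMean hZ hf n).mono hle le_rfl
    have h2 := ih.mono hle le_rfl
    have h3 := measurable_pastFiltration hZ n.lt_succ_self
    exact (measurable_mirrorStep (η n)).comp
      (((measurable_gradEstimate hf).comp ((h1.prodMk h2).prodMk h3)).prodMk h2)

end process

section convergence

variable {Q : Measure (Fin p → ℝ)} {f : (Fin p → ℝ) → ℝ} {Ω : Type*} [MeasurableSpace Ω]
  {P : Measure Ω} {X : ℕ → Ω → Fin p → ℝ}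

theorem integral_empiricalMean_pow_four_le (hf : Measurable f)
    (hf4 : Integrable (fun x => f x ^ 4) Q) (hXQ : ∀ n, MeasurePreserving (X n) P Q) (n : ℕ) :
    Integrable (fun ω => empiricalMean f (fun k => X k ω) n ^ 4) P ∧
      ∫ ω, empiricalMean f (fun k => X k ω) n ^ 4 ∂P ≤ ∫ x, f x ^ 4 ∂Q := by
  have hi : ∀ k, Integrable (fun ω => f (X k ω) ^ 4) P := fun k =>
    (hXQ k).integrable_comp_of_integrable hf4
  have hi' : Integrable (fun ω => (n : ℝ)⁻¹ * ∑ k ∈ Finset.range n, f (X k ω) ^ 4) P :=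
    (integrable_finsetSum _ fun k _ => hi k).const_mul _
  have hm : Measurable fun ω => empiricalMean f (fun k => X k ω) n :=
    Measurable.const_mul (Finset.measurable_sum _ fun k _ => hf.comp (hXQ k).measurable) _
  have hint : Integrable (fun ω => empiricalMean f (fun k => X k ω) n ^ 4) P := by
    refine hi'.mono' (hm.pow_const 4).aestronglyMeasurable (ae_of_all _ fun ω => ?_)
    rw [Real.norm_of_nonneg (by positivity)]
    exact empiricalMean_pow_four_le f _ n
  refine ⟨hint, (integral_mono hint hi' fun ω => empiricalMean_pow_four_le f _ n).trans ?_⟩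
  rw [integral_const_mul, integral_finsetSum _ fun k _ => hi k]
  simp_rw [fun k => integral_comp_measurePreserving (hXQ k) (hf.pow_const 4)]
  have hK : 0 ≤ ∫ x, f x ^ 4 ∂Q := integral_nonneg fun x => by positivity
  rw [Finset.sum_const, Finset.card_range, nsmul_eq_mul, ← mul_assoc]
  exact mul_le_of_le_one_left hK inv_mul_le_one

theorem integral_sub_empiricalMean_sq [IsProbabilityMeasure Q]
    [IsProbabilityMeasure P] (hf : Measurable f) (hf2 : MemLp f 2 Q)
    (hXQ : ∀ n, MeasurePreserving (X n) P Q) (hX : iIndepFun X P) (n : ℕ) :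
    Integrable (fun ω => ((∫ x, f x ∂Q) - empiricalMean f (fun k => X k ω) n) ^ 2) P ∧
      (n ≠ 0 → ∫ ω, ((∫ x, f x ∂Q) - empiricalMean f (fun k => X k ω) n) ^ 2 ∂P =
        Var[f; Q] / n) := by
  have hL : ∀ k, MemLp (fun ω => f (X k ω)) 2 P := fun k => hf2.comp_measurePreserving (hXQ k)
  have hmL : MemLp (fun ω => empiricalMean f (fun k => X k ω) n) 2 P :=
    (memLp_finsetSum _ fun k _ => hL k).const_mul _
  have hi : Integrable (fun ω => ((∫ x, f x ∂Q) - empiricalMean f (fun k => X k ω) n) ^ 2) P :=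
    ((memLp_const _).sub hmL).integrable_sq
  refine ⟨hi, fun hn => ?_⟩
  have hn' : (n : ℝ) ≠ 0 := by exact_mod_cast hn
  have hmean : ∫ ω, empiricalMean f (fun k => X k ω) n ∂P = ∫ x, f x ∂Q := by
    simp only [empiricalMean]
    rw [integral_const_mul, integral_finsetSum _ fun k _ => (hL k).integrable one_le_two]
    simp_rw [fun k => integral_comp_measurePreserving (hXQ k) hf]
    rw [Finset.sum_const, Finset.card_range, nsmul_eq_mul, inv_mul_cancel_left₀ hn']
  have hvar : ∀ k, Var[fun ω => f (X k ω); P] = Var[f; Q] := fun k => by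
    rw [variance_eq_sub (hL k), variance_eq_sub hf2, integral_comp_measurePreserving (hXQ k) hf]
    congr 1
    exact integral_comp_measurePreserving (hXQ k) (hf.pow_const 2)
  have h1 : ∫ ω, ((∫ x, f x ∂Q) - empiricalMean f (fun k => X k ω) n) ^ 2 ∂P =
      Var[fun ω => empiricalMean f (fun k => X k ω) n; P] := by
    rw [variance_eq_integral hmL.aemeasurable, hmean]
    exact integral_congr_ae (ae_of_all _ fun ω => sub_sq_comm _ _)
  have h2 : (fun ω => empiricalMean f (fun k => X k ω) n) =
      fun ω => (n : ℝ)⁻¹ * (∑ k ∈ Finset.range n, fun ω => f (X k ω)) ω := by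
    ext ω
    simp [empiricalMean]
  rw [h1, h2, variance_const_mul, IndepFun.variance_sum (fun k _ => hL k)
    fun i _ j _ hij => (hX.indepFun hij).comp hf hf, Finset.sum_congr rfl fun k _ => hvar k,
    Finset.sum_const, Finset.card_range, nsmul_eq_mul]
  field_simp

/-- The expectations are `Var(Y) η n / n`, and `η n / n ≤ η n ² + 1 / n²`; no rate on the steps
beyond square summability is required. -/
theorem ae_summable_mul_sub_empiricalMean_sq [IsProbabilityMeasure Q]
    [IsProbabilityMeasure P] (hf : Measurable f) (hf2 : MemLp f 2 Q)
    (hXQ : ∀ n, MeasurePreserving (X n) P Q) (hX : iIndepFun X P) {η : ℕ → ℝ}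
    (hη_pos : ∀ n, 0 < η n) (hη_sq : Summable fun n => η n ^ 2) :
    ∀ᵐ ω ∂P, Summable fun n =>
      η n * ((∫ x, f x ∂Q) - empiricalMean f (fun k => X k ω) n) ^ 2 := by
  have h := integral_sub_empiricalMean_sq hf hf2 hXQ hX
  refine ae_summable_of_summable_integral (fun n ω => mul_nonneg (hη_pos n).le (sq_nonneg _))
    (fun n => (h n).1.const_mul _) ?_
  simp_rw [integral_const_mul]
  -- The index `0` is dropped: the empirical mean is then the default `0` and the variance formula
  -- does not apply.
  rw [← summable_nat_add_iff 1]
  have hs : Summable fun n : ℕ => Var[f; Q] * (η (n + 1) ^ 2 + 1 / ((n + 1 : ℕ) : ℝ) ^ 2) :=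
    (((summable_nat_add_iff 1).2 hη_sq).add ((summable_nat_add_iff 1).2
      (Real.summable_one_div_nat_pow.2 one_lt_two))).mul_left _
  refine hs.of_nonneg_of_le (fun n => mul_nonneg (hη_pos _).le
    (integral_nonneg fun _ => sq_nonneg _)) fun n => ?_
  rw [(h (n + 1)).2 n.succ_ne_zero, div_eq_mul_one_div, mul_left_comm, ← one_div_pow]
  refine mul_le_mul_of_nonneg_left ?_ (variance_nonneg _ _)
  nlinarith [sq_nonneg (η (n + 1) - 1 / ((n + 1 : ℕ) : ℝ)), sq_nonneg (η (n + 1)),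
    sq_nonneg (1 / ((n + 1 : ℕ) : ℝ))]

end convergence

/-! ### Noise and almost sure convergence -/

/-- The decrease `⟨gradEstimate, t - s⟩` towards the Sobol' indices `t` minus its mean. -/
noncomputable def gradNoise (Q : Measure (Fin p → ℝ)) (f : (Fin p → ℝ) → ℝ) (a : SubsetVec p)
    (q : ℝ × SubsetVec p) (z : (Fin p → ℝ) × (Fin p → ℝ) × Finset (Fin p)) : ℝ :=
  ∑ v, gradEstimate f q.1 z.1 z.2.1 z.2.2 q.2 v * (sobolIndex Q f v - q.2 v) -
    meanDrift Q f a q.1 q.2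

theorem measurable_gradNoise (Q : Measure (Fin p → ℝ)) {f : (Fin p → ℝ) → ℝ} (hf : Measurable f)
    (a : SubsetVec p) : Measurable fun q : (ℝ × SubsetVec p) ×
      ((Fin p → ℝ) × (Fin p → ℝ) × Finset (Fin p)) => gradNoise Q f a q.1 q.2 := by
  refine (Finset.measurable_sum _ fun v _ => ?_).sub
    ((measurable_meanDrift Q f a).comp measurable_fst)
  exact ((measurable_pi_apply v).comp (measurable_gradEstimate hf)).mul (by fun_prop)

/-- A common bound for the squares of `gradBound` and `gradNoise`. -/
noncomputable def squareBound (Q : Measure (Fin p → ℝ)) (f : (Fin p → ℝ) → ℝ) (m : ℝ)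
    (z : (Fin p → ℝ) × (Fin p → ℝ) × Finset (Fin p)) : ℝ :=
  48 * (f z.1 ^ 4 + f (freeze z.2.2 z.1 z.2.1) ^ 4) + 128 * m ^ 4 +
    (4 * Var[f; Q] ^ 2 + 32 * (∫ x, f x ∂Q) ^ 4)

theorem gradBound_sq_le_squareBound (Q : Measure (Fin p → ℝ)) (f : (Fin p → ℝ) → ℝ) (m : ℝ)
    (z : (Fin p → ℝ) × (Fin p → ℝ) × Finset (Fin p)) :
    gradBound f m z.1 z.2.1 z.2.2 ^ 2 ≤ squareBound Q f m z := by
  have h := gradBound_sq_le f m z.1 z.2.1 z.2.2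
  have h1 : 0 ≤ f z.1 ^ 4 := by positivity
  have h2 : 0 ≤ f (freeze z.2.2 z.1 z.2.1) ^ 4 := by positivity
  have h3 : 0 ≤ m ^ 4 := by positivity
  have h4 : 0 ≤ Var[f; Q] ^ 2 := by positivity
  have h5 : 0 ≤ (∫ x, f x ∂Q) ^ 4 := by positivity
  rw [squareBound]
  linarith

theorem squareBound_nonneg (Q : Measure (Fin p → ℝ)) (f : (Fin p → ℝ) → ℝ) (m : ℝ)
    (z : (Fin p → ℝ) × (Fin p → ℝ) × Finset (Fin p)) : 0 ≤ squareBound Q f m z :=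
  (sq_nonneg _).trans (gradBound_sq_le_squareBound Q f m z)

/-- From `(x + y)² ≤ 2 (x² + y²)`: the coefficient `128` of `m ^ 4` is `2 · 48` from the gradient
bound plus `2 · 16` from the drift bound. -/
theorem gradNoise_sq_le {Q : Measure (Fin p → ℝ)} {f : (Fin p → ℝ) → ℝ} {a : SubsetVec p}
    (ha : ∀ u, 0 ≤ a u) (ha_sum : ∑ u, a u = 1) (hS : sobolIndex Q f ∈ simplex p)
    {q : ℝ × SubsetVec p} (hq : q.2 ∈ simplex p)
    (z : (Fin p → ℝ) × (Fin p → ℝ) × Finset (Fin p)) :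
    gradNoise Q f a q z ^ 2 ≤ squareBound Q f q.1 z := by
  have h := gradBound_sq_le f q.1 z.1 z.2.1 z.2.2
  have h1 := abs_sum_gradEstimate_mul_le (f := f) (m := q.1) (x := z.1) (x' := z.2.1)
    (u := z.2.2) hq hS
  have h2 := pow_le_pow_left₀ (abs_nonneg _) h1 2
  rw [sq_abs] at h2
  have h3 := meanDrift_sq_le ha ha_sum hS (m := q.1) hq
  have h4 := add_sq_le (a := ∑ v, gradEstimate f q.1 z.1 z.2.1 z.2.2 q.2 v *
    (sobolIndex Q f v - q.2 v)) (b := -meanDrift Q f a q.1 q.2)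
  rw [gradNoise, squareBound, sub_eq_add_neg]
  linarith [neg_sq (meanDrift Q f a q.1 q.2)]

theorem summable_integral_squareBound {Q : Measure (Fin p → ℝ)} {f : (Fin p → ℝ) → ℝ}
    {Ω : Type*} [MeasurableSpace Ω] {P : Measure Ω} {η : ℕ → ℝ} {W : ℕ → Ω → ℝ} {C : ℝ}
    {Z : ℕ → Ω → (Fin p → ℝ) × (Fin p → ℝ) × Finset (Fin p)}
    (hη_sq : Summable fun n => η n ^ 2)
    (hC : ∀ n, Integrable (fun ω => squareBound Q f (W n ω) (Z n ω)) P ∧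
      ∫ ω, squareBound Q f (W n ω) (Z n ω) ∂P ≤ C) :
    Summable fun n => ∫ ω, η n ^ 2 * squareBound Q f (W n ω) (Z n ω) ∂P := by
  refine (hη_sq.mul_right C).of_nonneg_of_le (fun n => integral_nonneg fun ω => ?_) fun n => ?_
  · exact mul_nonneg (sq_nonneg _) (squareBound_nonneg _ _ _ _)
  · rw [integral_const_mul]
    exact mul_le_mul_of_nonneg_left (hC n).2 (sq_nonneg _)

section convergence

variable {Q : Measure (Fin p → ℝ)} [IsProbabilityMeasure Q] {f : (Fin p → ℝ) → ℝ}
  {a : SubsetVec p} {Ω : Type*} [MeasurableSpace Ω] {P : Measure Ω} [IsProbabilityMeasure P]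
  {X X' : ℕ → Ω → Fin p → ℝ} {U : ℕ → Ω → Finset (Fin p)} {η : ℕ → ℝ}

/-- Both outputs have law that of `Y`, and by Jensen's inequality the fourth moment of the empirical
mean is at most that of `Y`, whence a constant independent of `n`. -/
theorem exists_integral_squareBound_le
    (hQ : iIndepFun (fun (i : Fin p) (x : Fin p → ℝ) => x i) Q) (hf : Measurable f)
    (hf4 : Integrable (fun x => f x ^ 4) Q) (ha : ∀ u, 0 ≤ a u) (ha_sum : ∑ u, a u = 1)
    (hZ : ∀ n, MeasurePreserving (fun ω => (X n ω, X' n ω, U n ω)) P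
      (Q.prod (Q.prod (subsetLaw a)))) :
    ∃ C, ∀ n, Integrable (fun ω => squareBound Q f (empiricalMean f (fun k => X k ω) n)
        (X n ω, X' n ω, U n ω)) P ∧
      ∫ ω, squareBound Q f (empiricalMean f (fun k => X k ω) n) (X n ω, X' n ω, U n ω) ∂P ≤ C := by
  have := isProbabilityMeasure_subsetLaw ha ha_sum
  have hX : ∀ n, MeasurePreserving (X n) P Q := fun n => measurePreserving_fst.comp (hZ n)
  have hF : ∀ n, MeasurePreserving (fun ω => freeze (U n ω) (X n ω) (X' n ω)) P Q := fun n =>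
    (measurePreserving_freeze_subsetLaw hQ ha ha_sum).comp (hZ n)
  refine ⟨48 * (∫ x, f x ^ 4 ∂Q + ∫ x, f x ^ 4 ∂Q) + 128 * ∫ x, f x ^ 4 ∂Q +
    (4 * Var[f; Q] ^ 2 + 32 * (∫ x, f x ∂Q) ^ 4), fun n => ?_⟩
  obtain ⟨i3, h3⟩ := integral_empiricalMean_pow_four_le hf hf4 hX n
  have i1 : Integrable (fun ω => f (X n ω) ^ 4) P := (hX n).integrable_comp_of_integrable hf4
  have i2 : Integrable (fun ω => f (freeze (U n ω) (X n ω) (X' n ω)) ^ 4) P :=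
    (hF n).integrable_comp_of_integrable hf4
  have h1 := integral_comp_measurePreserving (hX n) (hf.pow_const 4)
  have h2 := integral_comp_measurePreserving (hF n) (hf.pow_const 4)
  have i12 : Integrable (fun ω => f (X n ω) ^ 4 + f (freeze (U n ω) (X n ω) (X' n ω)) ^ 4) P :=
    i1.add i2
  have j1 : Integrable (fun ω => 48 * (f (X n ω) ^ 4 + f (freeze (U n ω) (X n ω) (X' n ω)) ^ 4) +
      128 * empiricalMean f (fun k => X k ω) n ^ 4) P :=
    (i12.const_mul 48).add (i3.const_mul 128)
  simp only [squareBound]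
  refine ⟨j1.add (integrable_const _), ?_⟩
  rw [integral_add j1 (integrable_const _), integral_add (i12.const_mul 48)
    (i3.const_mul 128), integral_const_mul, integral_const_mul, integral_add i1 i2, h1, h2,
    integral_const]
  simp only [probReal_univ, one_smul]
  linarith

theorem integral_gradNoise
    (hQ : iIndepFun (fun (i : Fin p) (x : Fin p → ℝ) => x i) Q) (hf : Measurable f)
    (hf2 : MemLp f 2 Q) (hvar : 0 < Var[f; Q]) (ha : ∀ u, 0 ≤ a u) (ha_sum : ∑ u, a u = 1)
    (q : ℝ × SubsetVec p) :
    ∫ z, gradNoise Q f a q z ∂(Q.prod (Q.prod (subsetLaw a))) = 0 := by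
  have := isProbabilityMeasure_subsetLaw ha ha_sum
  obtain ⟨hi, he⟩ := integral_sum_gradEstimate_mul hQ hf hf2 hvar ha q.1 q.2
  simp only [gradNoise]
  rw [integral_sub hi (integrable_const _), he]
  simp

theorem ae_exists_tendsto_sum_gradNoise
    (hQ : iIndepFun (fun (i : Fin p) (x : Fin p → ℝ) => x i) Q) (hf : Measurable f)
    (hf2 : MemLp f 2 Q) (hvar : 0 < Var[f; Q]) (ha : ∀ u, 0 ≤ a u) (ha_sum : ∑ u, a u = 1)
    (hη_sq : Summable fun n => η n ^ 2) (hS : sobolIndex Q f ∈ simplex p)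
    {Z : ℕ → Ω → (Fin p → ℝ) × (Fin p → ℝ) × Finset (Fin p)}
    (hZ : ∀ n, MeasurePreserving (Z n) P (Q.prod (Q.prod (subsetLaw a))))
    (hind : iIndepFun Z P) {W : ℕ → Ω → ℝ × SubsetVec p}
    (hW : ∀ n, Measurable[pastFiltration Z (fun n => (hZ n).measurable) n] (W n))
    (hWs : ∀ n ω, (W n ω).2 ∈ simplex p) {C : ℝ}
    (hC : ∀ n, Integrable (fun ω => squareBound Q f (W n ω).1 (Z n ω)) P ∧
      ∫ ω, squareBound Q f (W n ω).1 (Z n ω) ∂P ≤ C) :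
    ∀ᵐ ω ∂P, ∃ c, Tendsto
      (fun N => ∑ n ∈ Finset.range N, η n * gradNoise Q f a (W n ω) (Z n ω)) atTop (𝓝 c) := by
  have hZm : ∀ n, Measurable (Z n) := fun n => (hZ n).measurable
  have hnoise := measurable_gradNoise Q hf a
  have hξm : ∀ n, Measurable[pastFiltration Z hZm (n + 1)]
      fun ω => η n * gradNoise Q f a (W n ω) (Z n ω) := fun n =>
    (hnoise.comp (((hW n).mono ((pastFiltration Z hZm).mono n.le_succ) le_rfl).prodMk
      (measurable_pastFiltration hZm n.lt_succ_self))).const_mul _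
  have hξm' : ∀ n, Measurable fun ω => η n * gradNoise Q f a (W n ω) (Z n ω) := fun n =>
    (hξm n).mono ((pastFiltration Z hZm).le _) le_rfl
  have hξle : ∀ n ω, (η n * gradNoise Q f a (W n ω) (Z n ω)) ^ 2 ≤
      η n ^ 2 * squareBound Q f (W n ω).1 (Z n ω) := fun n ω => by
    rw [mul_pow]
    exact mul_le_mul_of_nonneg_left (gradNoise_sq_le ha ha_sum hS (hWs n ω) _) (sq_nonneg _)
  have hξi : ∀ n, Integrable (fun ω => (η n * gradNoise Q f a (W n ω) (Z n ω)) ^ 2) P := fun n =>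
    ((hC n).1.const_mul (η n ^ 2)).mono' ((hξm' n).pow_const 2).aestronglyMeasurable
      (ae_of_all _ fun ω => (Real.norm_of_nonneg (sq_nonneg _)).trans_le (hξle n ω))
  have hξ2 : ∀ n, MemLp (fun ω => η n * gradNoise Q f a (W n ω) (Z n ω)) 2 P := fun n =>
    (memLp_two_iff_integrable_sq (hξm' n).aestronglyMeasurable).2 (hξi n)
  refine ae_exists_tendsto_sum_of_orthogonal (pastFiltration Z hZm)
    (fun n => (hξm n).stronglyMeasurable) hξ2 (fun n φ hφ hφ2 => ?_) ?_
  -- The test function joins the mean and iterate in the past variable. For each fixed value of that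
  -- triple, the noise has zero integral under the law of the fresh sample.
  · have hV : Measurable[pastFiltration Z hZm n] fun ω => (φ ω, W n ω) :=
      hφ.measurable.prodMk (hW n)
    have hK : Measurable fun q : (ℝ × ℝ × SubsetVec p) ×
        ((Fin p → ℝ) × (Fin p → ℝ) × Finset (Fin p)) => gradNoise Q f a q.1.2 q.2 := by
      have hpr : Measurable fun q : (ℝ × ℝ × SubsetVec p) ×
          ((Fin p → ℝ) × (Fin p → ℝ) × Finset (Fin p)) => (q.1.2, q.2) :=
        measurable_fst.snd.prodMk measurable_snd
      have h := hnoise.comp hpr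
      exact h
    have hKm : Measurable (Function.uncurry fun (w : ℝ × ℝ × SubsetVec p)
        (z : (Fin p → ℝ) × (Fin p → ℝ) × Finset (Fin p)) =>
          w.1 * (η n * gradNoise Q f a w.2 z)) :=
      measurable_fst.fst.mul (hK.const_mul _)
    have hKi : Integrable (fun ω => φ ω * (η n * gradNoise Q f a (W n ω) (Z n ω))) P :=
      hφ2.integrable_mul (hξ2 n)
    refine integral_eq_zero_of_indepFun (indepFun_of_measurable_pastFiltration hZm hind hV)
      (hV.mono ((pastFiltration Z hZm).le _) le_rfl) (hZm n) hKm hKi fun w => ?_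
    rw [integral_const_mul, integral_const_mul, (hZ n).map_eq,
      integral_gradNoise hQ hf hf2 hvar ha ha_sum, mul_zero, mul_zero]
  · exact (summable_integral_squareBound (W := fun n ω => (W n ω).1) hη_sq hC).of_nonneg_of_le
      (fun n => integral_nonneg fun ω => sq_nonneg _) fun n =>
        integral_mono (hξi n) ((hC n).1.const_mul _) (hξle n)

theorem ae_tendsto_iterates
    (hQ : iIndepFun (fun (i : Fin p) (x : Fin p → ℝ) => x i) Q) (hf : Measurable f)
    (hf4 : Integrable (fun x => f x ^ 4) Q) (hvar : 0 < Var[f; Q])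
    (ha : ∀ u, 0 ≤ a u) (ha_sum : ∑ u, a u = 1) (ha_pos : ∀ u, u ≠ ∅ → 0 < a u)
    (hη_pos : ∀ n, 0 < η n)
    (hη_sum : Tendsto (fun N => ∑ n ∈ Finset.range N, η n) atTop atTop)
    (hη_sq : Summable fun n => η n ^ 2) {s₀ : SubsetVec p} (hs₀ : s₀ ∈ posSimplex p)
    (hZ : ∀ n, MeasurePreserving (fun ω => (X n ω, X' n ω, U n ω)) P
      (Q.prod (Q.prod (subsetLaw a))))
    (hind : iIndepFun (fun n ω => (X n ω, X' n ω, U n ω)) P) :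
    ∀ᵐ ω ∂P, Tendsto
      (fun n => iterates f η s₀ (fun k => X k ω) (fun k => X' k ω) (fun k => U k ω) n) atTop
      (𝓝 (sobolIndex Q f)) := by
  have := isProbabilityMeasure_subsetLaw ha ha_sum
  have hf2 : MemLp f 2 Q := by
    refine (memLp_two_iff_integrable_sq hf.aestronglyMeasurable).2 ?_
    refine ((integrable_const 1).add hf4).mono' (hf.pow_const 2).aestronglyMeasurable
      (ae_of_all _ fun x => ?_)
    rw [Real.norm_of_nonneg (sq_nonneg _), Pi.add_apply]
    nlinarith [sq_nonneg (f x ^ 2 - 1)]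
  have hS := sobolIndex_mem_simplex hQ hf hf2 hvar
  have hX : ∀ n, MeasurePreserving (X n) P Q := fun n => measurePreserving_fst.comp (hZ n)
  have hXind : iIndepFun X P := hind.comp (fun _ z => z.1) fun _ => measurable_fst
  have hZm : ∀ n, Measurable fun ω => (X n ω, X' n ω, U n ω) := fun n => (hZ n).measurable
  set Z : ℕ → Ω → (Fin p → ℝ) × (Fin p → ℝ) × Finset (Fin p) :=
    fun n ω => (X n ω, X' n ω, U n ω) with hZdef
  set m : ℕ → Ω → ℝ := fun n ω => empiricalMean f (fun k => X k ω) n with hm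
  set S : ℕ → Ω → SubsetVec p := fun n ω =>
    iterates f η s₀ (fun k => X k ω) (fun k => X' k ω) (fun k => U k ω) n with hSdef
  have hSpos : ∀ n ω, S n ω ∈ posSimplex p := fun n ω => iterates_mem_posSimplex f η hs₀ _ _ _ n
  have hW : ∀ n, Measurable[pastFiltration Z hZm n] fun ω => (m n ω, S n ω) := fun n =>
    (measurable_empiricalMean hZm hf n).prodMk (measurable_iterates hZm hf η s₀ n)
  obtain ⟨C, hC⟩ := exists_integral_squareBound_le hQ hf hf4 ha ha_sum hZ
  have hbound_sum := summable_integral_squareBound hη_sq hC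
  have hξsum := ae_exists_tendsto_sum_gradNoise hQ hf hf2 hvar ha ha_sum hη_sq hS hZ hind hW
    (fun n ω => (hSpos n ω).1) hC
  have hbound_ae : ∀ᵐ ω ∂P, Summable fun n => η n ^ 2 * squareBound Q f (m n ω) (Z n ω) :=
    ae_summable_of_summable_integral (fun n ω => mul_nonneg (sq_nonneg _) (squareBound_nonneg _ _ _ _))
      (fun n => (hC n).1.const_mul _) hbound_sum
  filter_upwards [hξsum, hbound_ae,
    ae_summable_mul_sub_empiricalMean_sq hf hf2 hX hXind hη_pos hη_sq] with ω h1 h2 h3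
  obtain ⟨c, hc⟩ := h1
  -- Descent inequality along the trajectory; the three errors are the martingale noise, the bias of
  -- the empirical mean, and the Hoeffding term.
  have hstep : ∀ n, relEntropy (sobolIndex Q f) (S (n + 1) ω) ≤
      relEntropy (sobolIndex Q f) (S n ω) -
        η n * (Var[f; Q] * closedGap a (sobolIndex Q f) (S n ω)) +
        (η n * gradNoise Q f a (m n ω, S n ω) (Z n ω) + η n * ((∫ x, f x ∂Q) - m n ω) ^ 2 +
          2 * (η n ^ 2 * squareBound Q f (m n ω) (Z n ω))) := by
    intro n
    have k1 := relEntropy_mirrorStep_le (hη_pos n) hS (hSpos n ω)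
      (g := stepGradient f (fun k => X k ω) (fun k => X' k ω) (fun k => U k ω) n (S n ω))
      (fun v => abs_gradEstimate_le (hSpos n ω).1 v)
    have k2 := abs_le.1 (abs_meanDrift_add_le ha ha_sum hS (m := m n ω) (hSpos n ω).1)
    have k3 := mul_le_mul_of_nonneg_left k2.2 (hη_pos n).le
    have k4 := mul_le_mul_of_nonneg_left (gradBound_sq_le_squareBound Q f (m n ω) (Z n ω))
      (sq_nonneg (η n))
    have k5 : η n * gradNoise Q f a (m n ω, S n ω) (Z n ω) = η n * ∑ v, stepGradient f (fun k => X k ω) (fun k => X' k ω)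
        (fun k => U k ω) n (S n ω) v * (sobolIndex Q f v - S n ω v) -
        η n * meanDrift Q f a (m n ω) (S n ω) := by
      rw [← mul_sub]
      rfl
    have k6 : S (n + 1) ω = mirrorStep (η n) (stepGradient f (fun k => X k ω)
      (fun k => X' k ω) (fun k => U k ω) n (S n ω)) (S n ω) := rfl
    rw [k6]
    have k4' : η n ^ 2 * gradBound f (m n ω) (X n ω) (X' n ω) (U n ω) ^ 2 ≤
      η n ^ 2 * squareBound Q f (m n ω) (Z n ω) := k4
    linarith
  obtain ⟨⟨l, hl⟩, hfreq⟩ := exists_tendsto_and_frequently_lt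
    (fun n => relEntropy_nonneg hS (hSpos n ω))
    (fun n => mul_nonneg hvar.le (closedGap_nonneg ha _ _)) hη_pos hη_sum
    ⟨_, by
      simp_rw [Finset.sum_add_distrib]
      exact (hc.add h3.hasSum.tendsto_sum_nat).add (h2.mul_left 2).hasSum.tendsto_sum_nat⟩ hstep
  -- Since `∑ η` diverges, the gap is small infinitely often; this only gives a subsequence, and
  -- convergence of the entropy transfers its limit `0` to the full sequence.
  obtain ⟨φ, hφ, hφ'⟩ := extraction_forall_of_frequently
    fun k : ℕ => hfreq (1 / ((k : ℝ) + 1)) (by positivity)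
  have hgap : Tendsto (fun k => closedGap a (sobolIndex Q f) (S (φ k) ω)) atTop (𝓝 0) := by
    have := (squeeze_zero (fun k => mul_nonneg hvar.le (closedGap_nonneg ha _ _))
      (fun k => (hφ' k).le) tendsto_one_div_add_atTop_nhds_zero_nat).const_mul Var[f; Q]⁻¹
    simpa only [inv_mul_cancel_left₀ hvar.ne', mul_zero] using this
  have hsub := tendsto_relEntropy_self
    (tendsto_of_closedGap ha ha_pos hS (fun k => (hSpos (φ k) ω).1) hgap)
  have hl0 : l = 0 := tendsto_nhds_unique (hl.comp hφ.tendsto_atTop) hsub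
  exact tendsto_of_relEntropy hS (fun n => hSpos n ω) (hl0 ▸ hl)

end convergence

end PickFreeze

theorem theorem3p2 {p : ℕ}
    -- the law of the input vector, with independent components, and the numerical code
    (Q : Measure (Fin p → ℝ)) [IsProbabilityMeasure Q]
    (hQ : iIndepFun (fun (i : Fin p) (x : Fin p → ℝ) => x i) Q)
    (f : (Fin p → ℝ) → ℝ) (hf : Measurable f)
    (hf4 : Integrable (fun x => f x ^ 4) Q) (hvar : 0 < Var[f; Q])
    -- the sampling distribution of the subsets
    (a : PickFreeze.SubsetVec p) (ha_nonneg : ∀ u, 0 ≤ a u) (ha_sum : ∑ u, a u = 1)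
    (ha_pos : ∀ u, u ≠ ∅ → 0 < a u)
    -- the step sizes
    (η : ℕ → ℝ) (hη_pos : ∀ n, 0 < η n)
    (hη_sum : Tendsto (fun N => ∑ n ∈ Finset.range N, η n) atTop atTop)
    (hη_sq : Summable fun n => η n ^ 2)
    -- the initial point
    (s₀ : PickFreeze.SubsetVec p) (hs₀ : s₀ ∈ PickFreeze.simplex p)
    (hs₀_pos : ∀ u, u ≠ ∅ → 0 < s₀ u)
    -- the i.i.d. samples
    {Ω : Type*} [MeasurableSpace Ω] (P : Measure Ω) [IsProbabilityMeasure P]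
    (X X' : ℕ → Ω → Fin p → ℝ) (U : ℕ → Ω → Finset (Fin p))
    (hX : ∀ n, Measurable (X n)) (hX' : ∀ n, Measurable (X' n)) (hU : ∀ n, Measurable (U n))
    (hindep : iIndepFun (fun n ω => (X n ω, X' n ω, U n ω)) P)
    (hlaw : ∀ n, P.map (fun ω => (X n ω, X' n ω, U n ω)) =
      Q.prod (Q.prod (PickFreeze.subsetLaw a)))
    -- the random iterates
    (S : ℕ → Ω → PickFreeze.SubsetVec p)
    (hS : ∀ n ω, S n ω = PickFreeze.iterates f η s₀
      (fun k => X k ω) (fun k => X' k ω) (fun k => U k ω) n) :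
    -- each step is the unique solution of the mirror descent minimization problem
    (∀ n ω, S (n + 1) ω ∈ PickFreeze.simplex p ∧
      ∀ s ∈ PickFreeze.simplex p, s ≠ S (n + 1) ω →
        PickFreeze.mirrorObjective (η n)
            (PickFreeze.stepGradient f (fun k => X k ω) (fun k => X' k ω) (fun k => U k ω) n
              (S n ω)) (S n ω) (S (n + 1) ω) <
          PickFreeze.mirrorObjective (η n)
            (PickFreeze.stepGradient f (fun k => X k ω) (fun k => X' k ω) (fun k => U k ω) n
              (S n ω)) (S n ω) s) ∧
    -- almost sure convergence to the Sobol' indices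
    ∀ᵐ ω ∂P, Tendsto (fun n => S n ω) atTop (𝓝 (PickFreeze.sobolIndex Q f)) := by
  have hs₀' : s₀ ∈ PickFreeze.posSimplex p := ⟨hs₀, hs₀_pos⟩
  have hZ : ∀ n, MeasurePreserving (fun ω => (X n ω, X' n ω, U n ω)) P
      (Q.prod (Q.prod (PickFreeze.subsetLaw a))) := fun n =>
    ⟨(hX n).prodMk ((hX' n).prodMk (hU n)), hlaw n⟩
  refine ⟨fun n ω => ?_, ?_⟩
  · have hpos : S n ω ∈ PickFreeze.posSimplex p := by
      rw [hS]
      exact PickFreeze.iterates_mem_posSimplex f η hs₀' _ _ _ n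
    have hstep : S (n + 1) ω = PickFreeze.mirrorStep (η n)
        (PickFreeze.stepGradient f (fun k => X k ω) (fun k => X' k ω) (fun k => U k ω) n
          (S n ω)) (S n ω) := by
      rw [hS, hS]
      rfl
    rw [hstep]
    exact ⟨(PickFreeze.mirrorStep_mem hpos).1, fun s hs hne =>
      PickFreeze.mirrorObjective_mirrorStep_lt (hη_pos n) hs hpos hne⟩
  · simp only [hS]
    exact PickFreeze.ae_tendsto_iterates hQ hf hf4 hvar ha_nonneg ha_sum ha_pos hη_pos hη_sum
      hη_sq hs₀' hZ hindep
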